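/- **Setting.** Fix a signature of function symbols with at least one constant, the equality predicate as its only predicate, and countably many variables. A literal is an unordered pair of terms with a polarity, written $s\approx t$ or $s\not\approx t$ ($s\mathrel{\dot\approx}t$ for either). A clause is a finite multiset of literals, and $\bot$ is the empty clause. Let $\succ_t$ be a reduction ordering on terms that is total on ground terms. The multiset extension of an ordering $\succ$ is given by $A\mathrel{\succ\!\!\succ}B$ iff $A\ne B$ and for every $x$ with $B(x)>A(x)$ there is $y\succ x$ with $A(y)>B(y)$. **Closure orderings.** A closure $e\cdot\sigma$ is a pair of an expression $e$ and a substitution $\sigma$; it represents $e\sigma$, and it is ground if $e\sigma$ is ground. Term closures are identified if they differ only in the names of variables and in the values of the substitution outside the variables of the term. Let $\succ_{tc}$ be any total well-founded ordering on ground term closures such that $s\cdot\sigma\succ_{tc}t\cdot\rho$ whenever $s\sigma\succ_t t\rho$, or $s\sigma=t\rho$ and $s$ is a proper instance of $t$ (that is, $s$ is an instance of $t$, but $t$ is not an instance of $s$). Let $$M_{lc}((s\approx t)\cdot\theta)=\{s\cdot\theta,\,t\cdot\theta\},\qquad M_{lc}((s\not\approx t)\cdot\theta)=\{s\cdot\theta,\,s\theta\cdot\mathrm{id},\,t\cdot\theta,\,t\theta\cdot\mathrm{id}\}.$$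 Literal closures are compared by applying the multiset extension $\succ_{lc}$ of $\succ_{tc}$ to their multisets $M_{lc}$, and are identified if these multisets are equal. Let $M_{cc}(C\cdot\sigma)=\{\ell\cdot\sigma\}$ if $C$ is a unit clause $\{\ell\}$, and $M_{cc}(C\cdot\sigma)=\{\ell\sigma\cdot\mathrm{id}\mid \ell\in C\}$ (as a multiset) otherwise. Clause closures are compared by $\succ_{cc}$, the multiset extension of $\succ_{lc}$ applied to the multisets $M_{cc}$. **Calculus.** A literal of a clause is maximal with respect to $\succ_t$ if one of its sides is a $\succ_t$-maximal element among all sides of literals of the clause. Fix a selection function, which selects in each clause at least one negative literal, or else all maximal literals. Selected literals are underlined, and a renamed copy of a clause inherits the selection. The inference rules are - Superposition: from $\underline{l\approx r}\vee C$ and $\underline{s[u]\mathrel{\dot\approx}t}\vee D$, renamed to have no variables in common, infer $(s[u\mapsto r]\mathrel{\dot\approx}t\vee C\vee D)\sigma$, where $\sigma=\mathrm{mgu}(l,u)$, $l\sigma\not\preceq_t r\sigma$, $s\sigma\not\preceq_t t\sigma$, and $u$ is not a variable (one occurrence of the subterm $u$ is replaced); - Equality resolution: from $\underline{s\not\approx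 t}\vee C$ infer $C\sigma$, where $\sigma=\mathrm{mgu}(s,t)$; - Equality factoring: from $\underline{s\approx t}\vee\underline{s'\approx t'}\vee C$ infer $(s\approx t\vee t\not\approx t'\vee C)\sigma$, where $\sigma=\mathrm{mgu}(s,s')$, $s\sigma\not\preceq_t t\sigma$ and $t\sigma\not\prec_t t'\sigma$. Most general unifiers are taken idempotent. **Redundancy.** Let $\mathrm{GClos}(N)$ be the set of all ground closures $C\cdot\theta$ with $C\in N$. A clause $C$ is closure redundant in $N$ if every ground closure $C\cdot\theta$ is entailed by a set of closures in $\mathrm{GClos}(N)$, each of them $\prec_{cc}C\cdot\theta$. An inference $C_1,\dots,C_n\vdash D$ with most general unifier $\sigma$ is closure redundant in $N$ if, for every substitution $\theta=\sigma\theta$ that makes $C_1,\dots,C_n,D$ ground, $D\cdot\theta$ is entailed by a set of closures in $\mathrm{GClos}(N)$, each of them smaller with respect to $\succ_{cc}$ than the maximum of $C_1\cdot\theta,\dots,C_n\cdot\theta$. The set $N$ is saturated up to closure redundancy if every inference whose premises are (renamed copies of) clauses of $N$ that are not closure redundant in $N$ is closure redundant in $N$. **Theorem.** The superposition calculus is refutationally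 complete with respect to closure redundancy: if a set $N$ of clauses is saturated up to closure redundancy and $\bot\notin N$, then $N$ is satisfiable. -/

import Mathlib

open FirstOrder FirstOrder.Language

universe u v

namespace Superposition

variable (L : FirstOrder.Language.{u, v})

/-- First-order terms over the function symbols of `L`, with variables `0, 1, 2, …`. -/
abbrev Tm := L.Term ℕ

/-- Substitutions.  They are only ever applied to terms, literals and clauses, in which finitely
many variables occur. -/
abbrev Subst := ℕ → Tm L

/-- A literal: an unordered pair of terms with a polarity. -/
structure Literal where
  pos : Bool
  sides : Sym2 (Tm L)

/-- A clause: a finite multiset of literals.  The empty clause is `0`. -/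
abbrev Clause := Multiset (Literal L)

variable {L}

/-- The identity substitution. -/
def idSubst : Subst L := Term.var

/-- The substitution that renames variables by the permutation `π`. -/
def renameSubst (π : Equiv.Perm ℕ) : Subst L := fun x => Term.var (π x)

/-- The composition "first `σ`, then `τ`". -/
def Subst.comp (σ τ : Subst L) : Subst L := fun x => (σ x).subst τ

/-- A term without variables. -/
def IsGround (t : Tm L) : Prop := t.varFinset = ∅

/-- The literal `s ≈ t` if `b` is true, and `s ≉ t` otherwise. -/
def lit (b : Bool) (s t : Tm L) : Literal L := ⟨b, s(s, t)⟩

namespace Literal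

def subst (ℓ : Literal L) (σ : Subst L) : Literal L :=
  ⟨ℓ.pos, ℓ.sides.map fun t => t.subst σ⟩

def IsGround (ℓ : Literal L) : Prop := ∀ t ∈ ℓ.sides, Superposition.IsGround t

/-- Truth of a literal in a structure under a valuation. -/
def Realize (ℓ : Literal L) (M : Type u) [L.Structure M] (v : ℕ → M) : Prop :=
  ∃ s t : Tm L, ℓ.sides = s(s, t) ∧
    ((ℓ.pos = true ∧ s.realize v = t.realize v) ∨ (ℓ.pos = false ∧ s.realize v ≠ t.realize v))

end Literal

namespace Clause

def subst (C : Clause L) (σ : Subst L) : Clause L := C.map fun ℓ => ℓ.subst σ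

def IsGround (C : Clause L) : Prop := ∀ ℓ ∈ C, ℓ.IsGround

/-- The set of variables of a clause. -/
def vars (C : Clause L) : Set ℕ := {x | ∃ ℓ ∈ C, ∃ t ∈ ℓ.sides, x ∈ t.varFinset}

/-- Truth of (the universal closure of) a clause in a structure. -/
def HoldsIn (C : Clause L) (M : Type u) [L.Structure M] : Prop :=
  ∀ v : ℕ → M, ∃ ℓ ∈ C, ℓ.Realize M v

end Clause

/-- A set of clauses is satisfiable if it has a (nonempty) model. -/
def Satisfiable (N : Set (Clause L)) : Prop :=
  ∃ (M : Type u) (_ : Nonempty M) (_ : L.Structure M), ∀ C ∈ N, C.HoldsIn M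

/-- The clauses in `G` entail the clause `D`. -/
def Entails (G : Set (Clause L)) (D : Clause L) : Prop :=
  ∀ (M : Type u) [Nonempty M] [L.Structure M], (∀ C ∈ G, C.HoldsIn M) → D.HoldsIn M

/-! ### Term orderings -/

/-- `Replace l r s s'`: the term `s'` arises from `s` by replacing the subterm `l` at one position
by `r`. -/
inductive Replace (l r : Tm L) : Tm L → Tm L → Prop
  | root : Replace l r l r
  | arg {n : ℕ} (f : L.Functions n) (ts : Fin n → Tm L) (i : Fin n) (t' : Tm L) :
      Replace l r (ts i) t' → Replace l r (Term.func f ts) (Term.func f (Function.update ts i t'))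

/-- `gt` is a reduction ordering (a well-founded strict ordering that is a rewrite relation) which
is total on ground terms. -/
structure IsReductionOrdering (gt : Tm L → Tm L → Prop) : Prop where
  irrefl : ∀ s, ¬ gt s s
  trans : ∀ s t w, gt s t → gt t w → gt s w
  wf : WellFounded fun s t => gt t s
  subst : ∀ s t (σ : Subst L), gt s t → gt (s.subst σ) (t.subst σ)
  replace : ∀ l r s s', gt l r → Replace l r s s' → gt s s'
  total : ∀ s t, IsGround s → IsGround t → s ≠ t → gt s t ∨ gt t s

/-- The (strict) multiset extension of an ordering. -/
def MultisetGt {α : Type*} (gt : α → α → Prop) (A B : Multiset α) : Prop :=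
  open Classical in
  A ≠ B ∧ ∀ x ∈ B, A.count x < B.count x → ∃ y ∈ A, gt y x ∧ B.count y < A.count y

/-! ### Closures and closure orderings -/

/-- `s` is strictly less general than `t`, that is, `s` is a proper instance of `t`. -/
def LessGeneral (s t : Tm L) : Prop :=
  (∃ θ : Subst L, t.subst θ = s) ∧ ¬ ∃ σ : Subst L, s.subst σ = t

/-- `s` and `t` are equal modulo renaming. -/
def Variant (s t : Tm L) : Prop := ∃ π : Equiv.Perm ℕ, s.relabel π = t

/-- Term closures `t·ρ`, as pairs, are identified if they differ only in the names of the variables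
and in the values of the substitution outside of the variables of the term.  (If `s` renamed
by `π` is `t` and `sσ = tρ`, then `σ x = ρ (π x)` for every variable `x` of `s`, and conversely.) -/
def closureSetoid (L : FirstOrder.Language.{u, v}) : Setoid (Tm L × Subst L) where
  r p q := Variant p.1 q.1 ∧ p.1.subst p.2 = q.1.subst q.2
  iseqv :=
    { refl := fun p => ⟨⟨Equiv.refl ℕ, Term.relabel_id p.1⟩, rfl⟩
      symm := by
        rintro p q ⟨⟨π, h⟩, e⟩
        refine ⟨⟨π.symm, ?_⟩, e.symm⟩
        rw [← h, Term.relabel_relabel]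
        simp
      trans := by
        rintro p q r ⟨⟨π, h⟩, e⟩ ⟨⟨π', h'⟩, e'⟩
        refine ⟨⟨π.trans π', ?_⟩, e.trans e'⟩
        rw [← h', ← h, Term.relabel_relabel]
        rfl }

/-- Term closures, modulo the identification `closureSetoid`. -/
def TermClosure (L : FirstOrder.Language.{u, v}) := Quotient (closureSetoid L)

namespace TermClosure

/-- The term closure `t·σ`. -/
def mk (t : Tm L) (σ : Subst L) : TermClosure L := Quotient.mk (closureSetoid L) (t, σ)

/-- The term that a closure represents: `tσ` for the closure `t·σ`. -/
def term (c : TermClosure L) : Tm L :=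
  Quotient.lift (s := closureSetoid L) (fun p : Tm L × Subst L => p.1.subst p.2)
    (fun _ _ h => h.2) c

def IsGround (c : TermClosure L) : Prop := Superposition.IsGround c.term

end TermClosure

/-- `gtc` is an ordering `≻_tc` for the term ordering `gt`: a total well-founded ordering on ground
term closures that extends the partial ordering by represented terms in which ties are broken in
favour of more general terms.  (Nothing is said about closures that are not ground.) -/
structure IsClosureOrdering (gt : Tm L → Tm L → Prop)
    (gtc : TermClosure L → TermClosure L → Prop) : Prop where
  extend : ∀ (s t : Tm L) (σ ρ : Subst L), IsGround (s.subst σ) → IsGround (t.subst ρ) →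
    (gt (s.subst σ) (t.subst ρ) ∨ (s.subst σ = t.subst ρ ∧ LessGeneral s t)) →
    gtc (TermClosure.mk s σ) (TermClosure.mk t ρ)
  irrefl : ∀ a : TermClosure L, a.IsGround → ¬ gtc a a
  trans : ∀ a b c : TermClosure L, a.IsGround → b.IsGround → c.IsGround →
    gtc a b → gtc b c → gtc a c
  wf : {a : TermClosure L | a.IsGround}.WellFoundedOn fun a b => gtc b a
  total : ∀ a b : TermClosure L, a.IsGround → b.IsGround → a ≠ b → gtc a b ∨ gtc b a

/-- The multiset `M_lc` of a literal closure: `{s·θ, t·θ}` for `(s ≈ t)·θ`, and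
`{s·θ, sθ·id, t·θ, tθ·id}` for `(s ≉ t)·θ`. -/
def Literal.closureMultiset (ℓ : Literal L) (θ : Subst L) : Multiset (TermClosure L) :=
  let A := ℓ.sides.toMultiset.map fun t => TermClosure.mk t θ
  let B := ℓ.sides.toMultiset.map fun t => TermClosure.mk (t.subst θ) idSubst
  if ℓ.pos then A else A + B

/-- The multiset `M_cc` of a clause closure, each literal closure being given by its multiset
`M_lc`: the literal closure `ℓ·θ` if `C` is the unit clause `{ℓ}`, and the closures `ℓθ·id` of
the literals `ℓ` in `C` otherwise. -/
def Clause.closureMultiset (C : Clause L) (θ : Subst L) : Multiset (Multiset (TermClosure L)) :=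
  if C.card = 1 then C.map fun ℓ => ℓ.closureMultiset θ
  else C.map fun ℓ => (ℓ.subst θ).closureMultiset idSubst

/-- The ordering `≻_lc` on literal closures, given by their multisets `M_lc`. -/
def LitClosureGt (gtc : TermClosure L → TermClosure L → Prop) :
    Multiset (TermClosure L) → Multiset (TermClosure L) → Prop :=
  MultisetGt gtc

/-- A clause closure `C·θ`. -/
structure ClauseClosure (L : FirstOrder.Language.{u, v}) where
  clause : Clause L
  sub : Subst L

/-- The clause that a clause closure represents. -/
def ClauseClosure.rep (c : ClauseClosure L) : Clause L := c.clause.subst c.sub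

/-- The ordering `≻_cc` on clause closures. -/
def ClauseClosureGt (gtc : TermClosure L → TermClosure L → Prop) (c d : ClauseClosure L) : Prop :=
  MultisetGt (LitClosureGt gtc) (c.clause.closureMultiset c.sub) (d.clause.closureMultiset d.sub)

/-- The set of ground closures of the clauses of `N`. -/
def GClos (N : Set (Clause L)) : Set (ClauseClosure L) :=
  {c | c.clause ∈ N ∧ c.rep.IsGround}

/-! ### The superposition calculus -/

/-- A literal of a clause is maximal with respect to the term ordering if one of its sides is
maximal among all terms that are sides of literals of the clause. -/
def IsMaximalLiteral (gt : Tm L → Tm L → Prop) (C : Clause L) (ℓ : Literal L) : Prop :=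
  ∃ s ∈ ℓ.sides, ∀ k ∈ C, ∀ t ∈ k.sides, ¬ gt t s

/-- A selection function selects, in every clause, a submultiset of the literals that contains
at least one negative literal, or else all (occurrences of) maximal literals. -/
def IsSelection (gt : Tm L → Tm L → Prop) (sel : Clause L → Clause L) : Prop :=
  open Classical in
  ∀ C : Clause L, sel C ≤ C ∧
    ((∃ ℓ ∈ sel C, ℓ.pos = false) ∨
      ∀ ℓ ∈ C, IsMaximalLiteral gt C ℓ → (sel C).count ℓ = C.count ℓ)

/-- `σ` is an (idempotent) most general unifier of `s` and `t`. -/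
structure IsMGU (σ : Subst L) (s t : Tm L) : Prop where
  unifies : s.subst σ = t.subst σ
  general : ∀ τ : Subst L, s.subst τ = t.subst τ → ∃ δ : Subst L, σ.comp δ = τ
  idem : σ.comp σ = σ

/-- The inferences of the superposition calculus.  `Inference gt Ps σ D`: from the premises in the
list `Ps`, each paired with the multiset of its selected literals, the clause `D` is inferred with
most general unifier `σ`. -/
inductive Inference (gt : Tm L → Tm L → Prop) :
    List (Clause L × Clause L) → Subst L → Clause L → Prop
  /-- `l ≈ r ∨ C`, `s[u] ≐ t ∨ D` infer `(s[u ↦ r] ≐ t ∨ C ∨ D)σ`, where `≐` is either polarity. -/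
  | superposition (C D A B : Clause L) (l r s t w s' : Tm L) (b : Bool) (σ : Subst L) :
      lit true l r ∈ A → lit b s t ∈ B →
      Disjoint (Clause.vars (lit true l r ::ₘ C)) (Clause.vars (lit b s t ::ₘ D)) →
      (∀ x : ℕ, w ≠ Term.var x) → Replace w r s s' → IsMGU σ l w →
      ¬ (gt (r.subst σ) (l.subst σ) ∨ l.subst σ = r.subst σ) →
      ¬ (gt (t.subst σ) (s.subst σ) ∨ s.subst σ = t.subst σ) →
      Inference gt [(lit true l r ::ₘ C, A), (lit b s t ::ₘ D, B)] σ
        (Clause.subst (lit b s' t ::ₘ (C + D)) σ)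
  /-- `s ≉ t ∨ C` infers `Cσ`. -/
  | equalityResolution (C A : Clause L) (s t : Tm L) (σ : Subst L) :
      lit false s t ∈ A → IsMGU σ s t →
      Inference gt [(lit false s t ::ₘ C, A)] σ (Clause.subst C σ)
  /-- `s ≈ t ∨ s' ≈ t' ∨ C` infers `(s ≈ t ∨ t ≉ t' ∨ C)σ`. -/
  | equalityFactoring (C A : Clause L) (s t s' t' : Tm L) (σ : Subst L) :
      lit true s t ::ₘ lit true s' t' ::ₘ 0 ≤ A → IsMGU σ s s' →
      ¬ (gt (t.subst σ) (s.subst σ) ∨ s.subst σ = t.subst σ) →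
      ¬ gt (t'.subst σ) (t.subst σ) →
      Inference gt [(lit true s t ::ₘ lit true s' t' ::ₘ C, A)] σ
        (Clause.subst (lit true s t ::ₘ lit false t t' ::ₘ C) σ)

/-! ### Closure redundancy -/

/-- `C` is closure redundant in `N`: each ground closure of `C` follows from smaller ground
closures of `N`. -/
def ClauseRedundant (gtc : TermClosure L → TermClosure L → Prop) (N : Set (Clause L))
    (C : Clause L) : Prop :=
  ∀ θ : Subst L, (C.subst θ).IsGround →
    ∃ G ⊆ GClos N, Entails (ClauseClosure.rep '' G) (C.subst θ) ∧
      ∀ g ∈ G, ClauseClosureGt gtc ⟨C, θ⟩ g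

/-- The inference with premises `Ps`, most general unifier `σ` and conclusion `D` is closure
redundant in `N`: for each grounding substitution `θ` that is an instance of `σ`, the closure
`D·θ` follows from ground closures of `N` that are smaller than the maximum of the premise
closures `P·θ` (that is, smaller than one of them). -/
def InferenceRedundant (gtc : TermClosure L → TermClosure L → Prop) (N : Set (Clause L))
    (Ps : List (Clause L)) (σ : Subst L) (D : Clause L) : Prop :=
  ∀ θ : Subst L, σ.comp θ = θ → (∀ P ∈ Ps, (Clause.subst P θ).IsGround) →
    (D.subst θ).IsGround →
    ∃ G ⊆ GClos N, Entails (ClauseClosure.rep '' G) (D.subst θ) ∧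
      ∀ g ∈ G, ∃ P ∈ Ps, ClauseClosureGt gtc ⟨P, θ⟩ g

/-- `P` with selected literals `A` is a renamed copy of the clause `C` with its selected
literals. -/
def IsCopy (sel : Clause L → Clause L) (C P A : Clause L) : Prop :=
  ∃ π : Equiv.Perm ℕ, P = C.subst (renameSubst π) ∧ A = (sel C).subst (renameSubst π)

/-- `N` is saturated up to closure redundancy: every inference whose premises are (renamed copies
of) clauses of `N` that are not closure redundant in `N` is closure redundant in `N`. -/
def Saturated (gt : Tm L → Tm L → Prop) (gtc : TermClosure L → TermClosure L → Prop)
    (sel : Clause L → Clause L) (N : Set (Clause L)) : Prop :=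
  ∀ (Ps : List (Clause L × Clause L)) (σ : Subst L) (D : Clause L), Inference gt Ps σ D →
    (∀ p ∈ Ps, ∃ C ∈ N, ¬ ClauseRedundant gtc N C ∧ IsCopy sel C p.1 p.2) →
    InferenceRedundant gtc N (Ps.map Prod.fst) σ D

end Superposition

/-! The model is a term model obtained by the Bachmair–Ganzinger construction, carried out along the
closure ordering. Ground closures of `N` are visited in the well-founded order of their multisets
`M_cc`, and a ground rewrite system `R` grows on the way. An equation is true in `R` if both sides
have the same normal form. A closure `C·θ` that is false in the rules collected so far contributes
`l → r` if `C` is not redundant, `l` is the largest side in `Cθ`, occurs in positive literals only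
and is irreducible, `l ≈ r` is an instance of a selected literal with `r` largest possible, and no
remaining literal `l ≈ w` has `nf R w = nf R r` (`Productive`). The resulting rules are reduced
(`isReduced_rulesOf`), so innermost evaluation gives unique normal forms and no confluence argument
is needed.

Two persistence facts tie the stages together. A closure that is true once the closures up to it
have contributed stays true (`trueIn_rulesOf_mono`), and the literals of a productive closure other
than the one that gave the rule stay false (`Produces.not_trueIn_rest`). The first rests on a
feature of `M_lc`: a negative literal also contributes `sθ·id`, the largest closure of the term
`sθ`, and therefore exceeds the positive literals whose larger side is `sθ`
(`litClosureGt_neg_pos`).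

Consider a closure `C·θ` that is false in the rules below it while all smaller closures are true.
Normalizing `θ` would yield a smaller closure of `C` with the same truth value, so `θ` is
irreducible (`IsCounterexample.nf_eq`); redexes in `Cθ` are therefore at nonvariable positions,
where superposition applies. Redundant clauses cannot be counterexamples
(`IsCounterexample.not_redundant`) and do not produce rules, so saturation covers every inference
that is needed. Its conclusion follows from closures below `C·θ`, hence is true; but each of its
literals is false, a contradiction. Thus no inference applies, which is exactly what makes a
nonempty counterexample productive (`IsCounterexample.exists_produces`), and its own rule then makes
it true (`trueIn_rulesOf_le`).

Different closures can have the same multiset, so the recursion runs over multisets. This is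
harmless because the multiset determines the positive literals (`mem_of_closureMultiset_eq`). -/

namespace Superposition

/-! ### Multiset extensions of well-orders on a set -/

section MultisetOrder

/-- `r` is, read as "greater than", a well-founded strict total order on the set `S`. -/
structure IsWellOrderOn {α : Type*} (S : Set α) (r : α → α → Prop) : Prop where
  irrefl : ∀ a ∈ S, ¬ r a a
  trans : ∀ a ∈ S, ∀ b ∈ S, ∀ c ∈ S, r a b → r b c → r a c
  total : ∀ a ∈ S, ∀ b ∈ S, a ≠ b → r a b ∨ r b a
  wf : WellFounded fun a b => a ∈ S ∧ b ∈ S ∧ r b a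

variable {α β : Type*} {S : Set α} {r : α → α → Prop}

theorem IsWellOrderOn.exists_max (h : IsWellOrderOn S r) {T : Set α} (hT : T.Finite)
    (hne : T.Nonempty) (hTS : T ⊆ S) : ∃ m ∈ T, ∀ x ∈ T, x = m ∨ r m x := by
  induction T, hT using Set.Finite.induction_on with
  | empty => exact absurd hne Set.not_nonempty_empty
  | @insert a T ha hT ih =>
    rcases T.eq_empty_or_nonempty with rfl | hTne
    · exact ⟨a, by simp, fun x hx => Or.inl (by simpa using hx)⟩
    obtain ⟨m, hm, hmax⟩ := ih hTne fun x hx => hTS (Set.mem_insert_of_mem _ hx)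
    have haS := hTS (Set.mem_insert a T)
    have hmS := hTS (Set.mem_insert_of_mem a hm)
    rcases h.total a haS m hmS (fun e => ha (e ▸ hm)) with ham | hma
    · refine ⟨a, Set.mem_insert _ _, ?_⟩
      rintro x (rfl | hx)
      · exact Or.inl rfl
      · rcases hmax x hx with rfl | hx'
        · exact Or.inr ham
        · exact Or.inr (h.trans a haS m hmS x (hTS (Set.mem_insert_of_mem _ hx)) ham hx')
    · refine ⟨m, Set.mem_insert_of_mem _ hm, ?_⟩
      rintro x (rfl | hx)
      · exact Or.inr hma
      · exact hmax x hx

theorem IsWellOrderOn.asymm (h : IsWellOrderOn S r) {a b : α} (ha : a ∈ S) (hb : b ∈ S)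
    (hab : r a b) : ¬ r b a := fun hba => h.irrefl a ha (h.trans a ha b hb a ha hab hba)

theorem multisetGt_of_forall_gt {A B : Multiset α} {y : α} (hirr : ¬ r y y) (hy : y ∈ A)
    (h : ∀ x ∈ B, r y x) : MultisetGt r A B := by
  classical
  have hyB : y ∉ B := fun hB => hirr (h y hB)
  refine ⟨fun e => hyB (e ▸ hy), fun x hx _ => ⟨y, hy, h x hx, ?_⟩⟩
  convert Multiset.count_pos.2 hy
  exact Multiset.count_eq_zero_of_notMem hyB

theorem MultisetGt.add_right {A B : Multiset α} (h : MultisetGt r A B) (D : Multiset α) :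
    MultisetGt r (A + D) (B + D) := by
  classical
  obtain ⟨hne, h⟩ := h
  refine ⟨fun e => hne (add_right_cancel e), fun x _ hx => ?_⟩
  simp only [Multiset.count_add] at hx ⊢
  obtain ⟨y, hy, hyx, hc⟩ := h x (Multiset.count_pos.1 (by omega)) (by convert (by omega :
    A.count x < B.count x))
  refine ⟨y, Multiset.mem_add.2 (Or.inl hy), hyx, ?_⟩
  convert Nat.add_lt_add_right hc (D.count y)

theorem MultisetGt.add_left {A B : Multiset α} (h : MultisetGt r A B) (D : Multiset α) :
    MultisetGt r (D + A) (D + B) := by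
  rw [add_comm D, add_comm D]
  exact h.add_right D

/-- Totality lets the largest element with different multiplicities decide the comparison.
Transitivity and totality are read off this lexicographic form. -/
theorem IsWellOrderOn.multisetGt_iff [DecidableEq α] (h : IsWellOrderOn S r) {A B : Multiset α}
    (hA : ∀ a ∈ A, a ∈ S) (hB : ∀ a ∈ B, a ∈ S) :
    MultisetGt r A B ↔
      ∃ m ∈ S, B.count m < A.count m ∧ ∀ y ∈ S, r y m → A.count y = B.count y := by
  constructor
  · rintro ⟨hne, hgt⟩
    have hfin : {x | A.count x ≠ B.count x}.Finite := by
      refine (A + B).toFinset.finite_toSet.subset fun x hx => ?_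
      by_contra hx'
      simp only [Finset.mem_coe, Multiset.mem_toFinset, Multiset.mem_add, not_or] at hx'
      exact hx (by rw [Multiset.count_eq_zero_of_notMem hx'.1,
        Multiset.count_eq_zero_of_notMem hx'.2])
    have hsub : {x | A.count x ≠ B.count x} ⊆ S := by
      intro x hx
      by_cases hxA : x ∈ A
      · exact hA x hxA
      · by_cases hxB : x ∈ B
        · exact hB x hxB
        · exact absurd (by rw [Multiset.count_eq_zero_of_notMem hxA,
            Multiset.count_eq_zero_of_notMem hxB]) hx
    have hnon : {x | A.count x ≠ B.count x}.Nonempty := by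
      by_contra hemp
      refine hne (Multiset.ext.2 fun x => ?_)
      by_contra hx
      exact hemp ⟨x, hx⟩
    obtain ⟨m, hm, hmax⟩ := h.exists_max hfin hnon hsub
    refine ⟨m, hsub hm, ?_, fun y hy hym => ?_⟩
    · by_contra hlt
      have hlt' : A.count m < B.count m := lt_of_le_of_ne (not_lt.1 hlt) hm
      obtain ⟨y, hy, hym, hc⟩ := hgt m (Multiset.count_pos.1 (by omega)) (by convert hlt')
      have hc' : B.count y < A.count y := by convert hc
      have hyd : A.count y ≠ B.count y := ne_of_gt hc'
      rcases hmax y hyd with rfl | hmy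
      · exact h.irrefl _ (hsub hm) hym
      · exact h.asymm (hsub hm) (hsub hyd) hmy hym
    · by_contra hyd
      rcases hmax y hyd with rfl | hmy
      · exact h.irrefl _ hy hym
      · exact h.asymm (hsub hm) hy hmy hym
  · rintro ⟨m, hm, hlt, heq⟩
    refine ⟨fun e => by rw [e] at hlt; exact lt_irrefl _ hlt, fun x hx hlt' => ?_⟩
    have hlt'' : A.count x < B.count x := by convert hlt'
    refine ⟨m, Multiset.count_pos.1 (by omega), ?_, by convert hlt⟩
    rcases h.total m hm x (hB x hx) (by rintro rfl; omega) with hmx | hxm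
    · exact hmx
    · have := heq x (hB x hx) hxm
      omega

theorem IsWellOrderOn.wellFounded_multisetGt (h : IsWellOrderOn S r) :
    WellFounded fun A B : Multiset α =>
      (∀ a ∈ A, a ∈ S) ∧ (∀ a ∈ B, a ∈ S) ∧ MultisetGt r B A := by
  classical
  -- In this preorder elements outside `S` are comparable only to themselves, so it is well-founded
  -- on all of `α` and the Dershowitz–Manna theorem applies.
  let _ : Preorder α :=
    { le := fun a b => a = b ∨ (a ∈ S ∧ b ∈ S ∧ r b a)
      lt := fun a b => a ∈ S ∧ b ∈ S ∧ r b a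
      le_refl := fun a => Or.inl rfl
      le_trans := by
        rintro a b c (rfl | ⟨ha, hb, hab⟩) (rfl | ⟨hb', hc, hbc⟩)
        · exact Or.inl rfl
        · exact Or.inr ⟨hb', hc, hbc⟩
        · exact Or.inr ⟨ha, hb, hab⟩
        · exact Or.inr ⟨ha, hc, h.trans c hc b hb a ha hbc hab⟩
      lt_iff_le_not_ge := by
        intro a b
        constructor
        · rintro ⟨ha, hb, hab⟩
          refine ⟨Or.inr ⟨ha, hb, hab⟩, ?_⟩
          rintro (rfl | ⟨_, _, hba⟩)
          · exact h.irrefl _ ha hab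
          · exact h.asymm ha hb hba hab
        · rintro ⟨rfl | hab, hn⟩
          · exact absurd (Or.inl rfl) hn
          · exact hab }
  have : WellFoundedLT α := ⟨h.wf⟩
  refine Subrelation.wf ?_ (Multiset.wellFounded_isDershowitzMannaLT (α := α))
  rintro A B ⟨hA, hB, hne, hgt⟩
  -- The common part is kept, and `A - B` takes the place of `B - A`, which is nonempty.
  refine ⟨A ∩ B, A - B, B - A, ?_, ?_, ?_, ?_⟩
  · intro h0
    rw [Multiset.empty_eq_zero] at h0
    have hle : B ≤ A := tsub_eq_zero_iff_le.1 h0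
    refine hne (le_antisymm hle (Multiset.le_iff_count.2 fun x => ?_))
    by_contra hx
    obtain ⟨y, _, _, hc⟩ := hgt x (Multiset.count_pos.1 (by omega))
      (by convert not_le.1 hx)
    have hc' : A.count y < B.count y := by convert hc
    exact absurd (Multiset.le_iff_count.1 hle y) (not_le.2 hc')
  · ext x
    simp only [Multiset.count_add, Multiset.count_inter, Multiset.count_sub]
    omega
  · ext x
    simp only [Multiset.count_add, Multiset.count_inter, Multiset.count_sub]
    omega
  · intro x hx
    have hx' : B.count x < A.count x := by
      have := Multiset.count_pos.2 hx
      rw [Multiset.count_sub] at this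
      omega
    have hxA : x ∈ A := Multiset.count_pos.1 (by omega)
    obtain ⟨y, hy, hyx, hc⟩ := hgt x hxA (by convert hx')
    have hc' : A.count y < B.count y := by convert hc
    refine ⟨y, Multiset.count_pos.1 (by rw [Multiset.count_sub]; omega), hA x hxA, hB y hy, hyx⟩

theorem IsWellOrderOn.multisetGt (h : IsWellOrderOn S r) :
    IsWellOrderOn {A : Multiset α | ∀ a ∈ A, a ∈ S} (MultisetGt r) := by
  classical
  refine ⟨fun A _ hA => hA.1 rfl, ?_, ?_, h.wellFounded_multisetGt⟩
  · intro A hA B hB D hD hAB hBD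
    rw [h.multisetGt_iff hA hB] at hAB
    rw [h.multisetGt_iff hB hD] at hBD
    rw [h.multisetGt_iff hA hD]
    obtain ⟨m, hm, h1, h2⟩ := hAB
    obtain ⟨m', hm', h1', h2'⟩ := hBD
    by_cases hmm : m = m'
    · subst hmm
      exact ⟨m, hm, h1'.trans h1, fun y hy hym => (h2 y hy hym).trans (h2' y hy hym)⟩
    · rcases h.total m hm m' hm' hmm with hgt | hgt
      · exact ⟨m, hm, by rw [← h2' m hm hgt]; exact h1, fun y hy hym =>
          (h2 y hy hym).trans (h2' y hy (h.trans y hy m hm m' hm' hym hgt))⟩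
      · exact ⟨m', hm', by rw [h2 m' hm' hgt]; exact h1', fun y hy hym =>
          (h2 y hy (h.trans y hy m' hm' m hm hym hgt)).trans (h2' y hy hym)⟩
  · intro A hA B hB hne
    by_cases hAB : MultisetGt r A B
    · exact Or.inl hAB
    · right
      refine ⟨fun e => hne e.symm, ?_⟩
      by_contra hcon
      push Not at hcon
      obtain ⟨x, hx, hlt, hmax⟩ := hcon
      have hlt' : B.count x < A.count x := by convert hlt
      rw [h.multisetGt_iff hA hB] at hAB
      -- Nowhere above `x` does `B` exceed `A`. Hence the multisets agree above the largest `m` at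
      -- which `A` exceeds `B`, and `A` is greater after all.
      have hfin : {x | B.count x < A.count x}.Finite :=
        A.toFinset.finite_toSet.subset fun y hy => by
          simpa using Multiset.count_pos.1 (by have : B.count y < A.count y := hy; omega)
      obtain ⟨m, hm, hm'⟩ := h.exists_max hfin ⟨x, hlt'⟩ fun y hy =>
        hA y (Multiset.count_pos.1 (by have : B.count y < A.count y := hy; omega))
      have hmA : m ∈ A := Multiset.count_pos.1 (by have : B.count m < A.count m := hm; omega)
      refine hAB ⟨m, hA m hmA, hm, fun y hy hym => ?_⟩
      by_contra hyd
      rcases lt_or_gt_of_ne hyd with hc | hc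
      · have hyB : y ∈ B := Multiset.count_pos.1 (by omega)
        have hc2 := hmax y hyB
        rcases hm' x hlt' with rfl | hmx
        · exact absurd (hc2 hym) (by rw [not_le]; convert hc)
        · exact absurd (hc2 (h.trans y hy m (hA m hmA) x (hA x hx) hym hmx))
            (by rw [not_le]; convert hc)
      · rcases hm' y hc with rfl | hmy
        · exact h.irrefl _ hy hym
        · exact h.asymm (hA m hmA) hy hmy hym

/-- The first alternative records pointwise equality and not just equality of the images, so that
one strict inequality rules it out. -/
theorem IsWellOrderOn.multisetGt_map (h : IsWellOrderOn S r) {C : Multiset β} {f g : β → α}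
    (hf : ∀ x ∈ C, f x ∈ S) (hg : ∀ x ∈ C, g x ∈ S) (hle : ∀ x ∈ C, f x = g x ∨ r (f x) (g x)) :
    C.map f = C.map g ∧ (∀ x ∈ C, f x = g x) ∨ MultisetGt r (C.map f) (C.map g) := by
  induction C using Multiset.induction with
  | empty => left; simp
  | cons a C ih =>
    have ih := ih (fun x hx => hf x (Multiset.mem_cons_of_mem hx))
      (fun x hx => hg x (Multiset.mem_cons_of_mem hx))
      fun x hx => hle x (Multiset.mem_cons_of_mem hx)
    have haf := hf a (Multiset.mem_cons_self a C)
    have hag := hg a (Multiset.mem_cons_self a C)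
    rw [Multiset.map_cons, Multiset.map_cons, ← Multiset.singleton_add (f a),
      ← Multiset.singleton_add (g a)]
    have hstep : f a ≠ g a → MultisetGt r ({f a} + C.map f) ({g a} + C.map f) := by
      intro hne
      have hgt := (hle a (Multiset.mem_cons_self a C)).resolve_left hne
      refine MultisetGt.add_right (multisetGt_of_forall_gt (h.irrefl _ haf)
        (Multiset.mem_singleton_self _) ?_) _
      simpa using hgt
    rcases ih with ⟨e, he⟩ | hgt
    · rw [← e]
      by_cases ha : f a = g a
      · left
        refine ⟨by rw [ha], ?_⟩
        intro x hx
        rcases Multiset.mem_cons.1 hx with rfl | hx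
        · exact ha
        · exact he x hx
      · exact Or.inr (hstep ha)
    · right
      have h2 := hgt.add_left {g a}
      by_cases ha : f a = g a
      · rwa [ha]
      · refine h.multisetGt.trans _ ?_ _ ?_ _ ?_ (hstep ha) h2 <;>
          intro x hx <;>
          simp only [Multiset.mem_add, Multiset.mem_singleton, Multiset.mem_map] at hx
        all_goals
          rcases hx with rfl | ⟨y, hy, rfl⟩
          · assumption
          · first
            | exact hf y (Multiset.mem_cons_of_mem hy)
            | exact hg y (Multiset.mem_cons_of_mem hy)

end MultisetOrder

/-! ### Substitution, unification and reduction orderings -/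

section Terms

variable {L : FirstOrder.Language.{u, v}}

theorem subst_subst (t : Tm L) (σ τ : Subst L) :
    (t.subst σ).subst τ = t.subst (σ.comp τ) := by
  induction t with
  | var x => rfl
  | func f ts ih => simp [Term.subst, ih]

theorem subst_idSubst (t : Tm L) : t.subst idSubst = t := by
  induction t with
  | var x => rfl
  | func f ts ih => simp [Term.subst, ih]

theorem subst_renameSubst (t : Tm L) (π : Equiv.Perm ℕ) :
    t.subst (renameSubst π) = t.relabel π := by
  induction t with
  | var x => rfl
  | func f ts ih => simp [Term.subst, Term.relabel, ih]

theorem mem_varFinset_func {n : ℕ} {f : L.Functions n} {ts : Fin n → Tm L} {x : ℕ} :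
    x ∈ (Term.func f ts : Tm L).varFinset ↔ ∃ i, x ∈ (ts i).varFinset := by
  simp [Term.varFinset]

theorem subst_eq_subst_iff {t : Tm L} {σ τ : Subst L} :
    t.subst σ = t.subst τ ↔ ∀ x ∈ t.varFinset, σ x = τ x := by
  induction t with
  | var x => simp [Term.subst, Term.varFinset]
  | func f ts ih =>
    simp only [Term.subst, Term.func.injEq, heq_eq_eq, true_and, funext_iff, ih,
      mem_varFinset_func]
    exact ⟨fun h x ⟨i, hi⟩ => h i x hi, fun h i x hi => h x ⟨i, hi⟩⟩

theorem mem_varFinset_subst {t : Tm L} {σ : Subst L} {y : ℕ} :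
    y ∈ (t.subst σ).varFinset ↔ ∃ x ∈ t.varFinset, y ∈ (σ x).varFinset := by
  induction t with
  | var x => simp [Term.subst, Term.varFinset]
  | func f ts ih =>
    simp only [Term.subst, mem_varFinset_func, ih]
    exact ⟨fun ⟨i, x, hx, hy⟩ => ⟨x, ⟨i, hx⟩, hy⟩, fun ⟨x, ⟨i, hx⟩, hy⟩ => ⟨i, x, hx, hy⟩⟩

theorem isGround_iff {t : Tm L} : IsGround t ↔ ∀ x, x ∉ t.varFinset :=
  Finset.eq_empty_iff_forall_notMem

theorem isGround_func {n : ℕ} {f : L.Functions n} {ts : Fin n → Tm L} :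
    IsGround (Term.func f ts) ↔ ∀ i, IsGround (ts i) := by
  simp only [isGround_iff, mem_varFinset_func, not_exists]
  exact ⟨fun h i x => h x i, fun h x i => h i x⟩

theorem isGround_subst {t : Tm L} {σ : Subst L} :
    IsGround (t.subst σ) ↔ ∀ x ∈ t.varFinset, IsGround (σ x) := by
  simp only [isGround_iff, mem_varFinset_subst, not_exists, not_and]
  exact ⟨fun h x hx y => h y x hx, fun h y x hx => h x hx y⟩

theorem IsGround.subst_eq {t : Tm L} (h : IsGround t) (σ : Subst L) : t.subst σ = t := by
  conv_rhs => rw [← subst_idSubst t]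
  exact subst_eq_subst_iff.2 fun x hx => absurd hx (isGround_iff.1 h x)

theorem not_isGround_var (x : ℕ) : ¬ IsGround (Term.var x : Tm L) := by
  simp [IsGround, Term.varFinset]

/-! ### Unification -/

/-- The number of symbols of a term. -/
def size : Tm L → ℕ
  | .var _ => 1
  | .func _ ts => 1 + ∑ i, size (ts i)

theorem size_arg_lt {n : ℕ} (f : L.Functions n) (ts : Fin n → Tm L) (i : Fin n) :
    size (ts i) < size (Term.func f ts) := by
  have := Finset.single_le_sum (f := fun i => size (ts i)) (fun _ _ => Nat.zero_le _)
    (Finset.mem_univ i)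
  simp only [size]
  omega

theorem size_le_size_subst {t : Tm L} {x : ℕ} (hx : x ∈ t.varFinset) (τ : Subst L) :
    size (τ x) ≤ size (t.subst τ) := by
  induction t with
  | var y =>
    obtain rfl : x = y := by simpa [Term.varFinset] using hx
    exact le_rfl
  | func f ts ih =>
    obtain ⟨i, hi⟩ := mem_varFinset_func.1 hx
    exact (ih i hi).trans (size_arg_lt f (fun i => (ts i).subst τ) i).le

/-- The occurs check: an instance of a term is strictly larger than the instance of a variable
properly inside it. -/
theorem subst_ne_of_mem_varFinset {t : Tm L} {x : ℕ} (hx : x ∈ t.varFinset)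
    (hne : t ≠ Term.var x) (τ : Subst L) : τ x ≠ t.subst τ := by
  cases t with
  | var y =>
    obtain rfl : x = y := by simpa [Term.varFinset] using hx
    exact absurd rfl hne
  | func f ts =>
    obtain ⟨i, hi⟩ := mem_varFinset_func.1 hx
    have h1 := size_le_size_subst hi τ
    have h2 := size_arg_lt f (fun i => (ts i).subst τ) i
    intro h
    rw [h] at h1
    exact absurd h2 (not_lt.2 h1)

/-- Descending along differing arguments under equal function symbols ends at a variable on one
side; the opposite subterm is a value that every unifier must respect. -/
theorem exists_binding_of_unifiable {s t : Tm L} (hne : s ≠ t) {τ₀ : Subst L}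
    (h₀ : s.subst τ₀ = t.subst τ₀) :
    ∃ (x : ℕ) (w : Tm L), x ∈ s.varFinset ∪ t.varFinset ∧ x ∉ w.varFinset ∧
      w.varFinset ⊆ s.varFinset ∪ t.varFinset ∧
      ∀ τ : Subst L, s.subst τ = t.subst τ → τ x = w.subst τ := by
  induction s generalizing t with
  | var y =>
    refine ⟨y, t, by simp [Term.varFinset], fun hy => ?_, Finset.subset_union_right,
      fun τ h => h⟩
    exact subst_ne_of_mem_varFinset hy hne.symm τ₀ h₀
  | @func n f ts ih =>
    cases t with
    | var y =>
      refine ⟨y, Term.func f ts, by simp [Term.varFinset], fun hy => ?_,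
        Finset.subset_union_left, fun τ h => h.symm⟩
      exact subst_ne_of_mem_varFinset hy hne τ₀ h₀.symm
    | @func m g us =>
      have h₀' := h₀
      simp only [Term.subst, Term.func.injEq] at h₀'
      obtain ⟨rfl, hfg, hts⟩ := h₀'
      obtain rfl := eq_of_heq hfg
      have hex : ∃ i, ts i ≠ us i := by
        by_contra hcon
        push Not at hcon
        exact hne (by rw [funext hcon])
      obtain ⟨i, hi⟩ := hex
      have inj : ∀ τ : Subst L, (Term.func f ts).subst τ = (Term.func f us).subst τ →
          (ts i).subst τ = (us i).subst τ := by
        intro τ h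
        simp only [Term.subst, Term.func.injEq, heq_eq_eq, true_and] at h
        exact congrFun h i
      obtain ⟨x, w, hx, hxw, hw, hτ⟩ := ih i hi (inj τ₀ h₀)
      have hsub : (ts i).varFinset ∪ (us i).varFinset ⊆
          (Term.func f ts).varFinset ∪ (Term.func f us).varFinset :=
        Finset.union_subset_union (fun x hx => mem_varFinset_func.2 ⟨i, hx⟩)
          fun x hx => mem_varFinset_func.2 ⟨i, hx⟩
      exact ⟨x, w, hsub hx, hxw, hw.trans hsub, fun τ h => hτ τ (inj τ h)⟩

/-- Absorption `σ.comp τ = τ` by every unifier `τ` is more convenient than generality: taking `τ =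
σ` it also gives idempotence. The induction is on the number of variables of the problem. -/
theorem exists_subst_absorbing_unifiers (s t : Tm L) (τ₀ : Subst L)
    (h₀ : s.subst τ₀ = t.subst τ₀) :
    ∃ σ : Subst L, s.subst σ = t.subst σ ∧
      ∀ τ : Subst L, s.subst τ = t.subst τ → σ.comp τ = τ := by
  induction hn : (s.varFinset ∪ t.varFinset).card using Nat.strong_induction_on
    generalizing s t with
  | _ n ih =>
    subst hn
    by_cases hst : s = t
    · exact ⟨idSubst, by rw [hst], fun τ _ => rfl⟩
    obtain ⟨x, w, hx, hxw, hw, hbind⟩ := exists_binding_of_unifiable hst h₀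
    -- The binding `x ↦ w` is forced, so every unifier absorbs `β`; and `x` disappears since it does
    -- not occur in `w`.
    set β : Subst L := Function.update idSubst x w with hβ
    have hβx : β x = w := Function.update_self ..
    have hβy : ∀ y, y ≠ x → β y = Term.var y := fun y hy => Function.update_of_ne hy ..
    have hβτ : ∀ τ : Subst L, s.subst τ = t.subst τ → β.comp τ = τ := by
      intro τ hτ
      funext y
      by_cases hy : y = x
      · subst hy
        simp only [Subst.comp, hβx]
        exact (hbind τ hτ).symm
      · simp only [Subst.comp, hβy y hy]
        rfl
    have hlt : ((s.subst β).varFinset ∪ (t.subst β).varFinset).card <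
        (s.varFinset ∪ t.varFinset).card := by
      apply Finset.card_lt_card
      have aux : ∀ r : Tm L, r.varFinset ⊆ s.varFinset ∪ t.varFinset →
          ∀ y ∈ (r.subst β).varFinset, y ∈ s.varFinset ∪ t.varFinset ∧ y ≠ x := by
        intro r hr y hy
        obtain ⟨z, hz, hyz⟩ := mem_varFinset_subst.1 hy
        by_cases hzx : z = x
        · subst hzx
          rw [hβx] at hyz
          exact ⟨hw hyz, fun e => hxw (e ▸ hyz)⟩
        · rw [hβy z hzx] at hyz
          obtain rfl : y = z := by simpa [Term.varFinset] using hyz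
          exact ⟨hr hz, hzx⟩
      have aux' : ∀ y ∈ (s.subst β).varFinset ∪ (t.subst β).varFinset,
          y ∈ s.varFinset ∪ t.varFinset ∧ y ≠ x := by
        intro y hy
        rcases Finset.mem_union.1 hy with hy | hy
        · exact aux s Finset.subset_union_left y hy
        · exact aux t Finset.subset_union_right y hy
      refine ⟨fun y hy => (aux' y hy).1, fun hsub => ?_⟩
      exact (aux' x (hsub hx)).2 rfl
    have hcomp : ∀ τ : Subst L, s.subst τ = t.subst τ →
        (s.subst β).subst τ = (t.subst β).subst τ := by
      intro τ hτ
      rw [subst_subst, subst_subst, hβτ τ hτ, hτ]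
    obtain ⟨σ, hσ, hgen⟩ := ih _ hlt (s.subst β) (t.subst β) (hcomp τ₀ h₀) rfl
    refine ⟨β.comp σ, by rw [← subst_subst, ← subst_subst, hσ], fun τ hτ => ?_⟩
    have h1 := hgen τ (hcomp τ hτ)
    funext y
    have h2 := congrFun (hβτ τ hτ) y
    simp only [Subst.comp] at h2 ⊢
    rw [subst_subst, h1, h2]

theorem exists_isMGU {s t : Tm L} {τ : Subst L} (h : s.subst τ = t.subst τ) :
    ∃ σ : Subst L, IsMGU σ s t ∧ σ.comp τ = τ := by
  obtain ⟨σ, hσ, hgen⟩ := exists_subst_absorbing_unifiers s t τ h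
  exact ⟨σ, ⟨hσ, fun ρ hρ => ⟨ρ, hgen ρ hρ⟩, hgen σ hσ⟩, hgen τ h⟩

/-! ### Subterms and replacement -/

/-- `IsSubterm w s`: the term `w` is a subterm of `s`. -/
inductive IsSubterm (w : Tm L) : Tm L → Prop
  | refl : IsSubterm w w
  | arg {n : ℕ} (f : L.Functions n) (ts : Fin n → Tm L) (i : Fin n) :
      IsSubterm w (ts i) → IsSubterm w (Term.func f ts)

theorem IsSubterm.exists_replace {w s : Tm L} (h : IsSubterm w s) (r : Tm L) :
    ∃ s', Replace w r s s' := by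
  induction h with
  | refl => exact ⟨r, Replace.root⟩
  | arg f ts i _ ih =>
    obtain ⟨s', hs'⟩ := ih
    exact ⟨_, Replace.arg f ts i s' hs'⟩

theorem Replace.subst {w r s s' : Tm L} (h : Replace w r s s') (τ : Subst L) :
    Replace (w.subst τ) (r.subst τ) (s.subst τ) (s'.subst τ) := by
  induction h with
  | root => exact Replace.root
  | @arg n f ts i t' _ ih =>
    have hfun : (fun j => (Function.update ts i t' j).subst τ) =
        Function.update (fun j => (ts j).subst τ) i (t'.subst τ) := by
      funext j
      by_cases hj : j = i
      · subst hj; simp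
      · simp [hj]
    have := Replace.arg f (fun j => (ts j).subst τ) i _ ih
    rw [← hfun] at this
    exact this

theorem Replace.isGround {w r s s' : Tm L} (h : Replace w r s s') (hs : IsGround s)
    (hr : IsGround r) : IsGround s' := by
  induction h with
  | root => exact hr
  | @arg n f ts i t' _ ih =>
    rw [isGround_func] at hs ⊢
    intro j
    by_cases hj : j = i
    · subst hj; simpa using ih (hs j)
    · simpa [hj] using hs j

/-! ### Reduction orderings on ground terms -/

variable {gt : Tm L → Tm L → Prop}

/-- The reflexive closure of an ordering `gt` ("greater than"), read as "less than or equal". -/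
def WeakLe {α : Type*} (gt : α → α → Prop) (a b : α) : Prop := a = b ∨ gt b a

theorem IsReductionOrdering.le_trans (h : IsReductionOrdering gt) {a b c : Tm L}
    (hab : WeakLe gt a b) (hbc : WeakLe gt b c) : WeakLe gt a c := by
  rcases hab with rfl | hab
  · exact hbc
  · rcases hbc with rfl | hbc
    · exact Or.inr hab
    · exact Or.inr (h.trans _ _ _ hbc hab)

theorem IsReductionOrdering.gt_of_le_of_gt (h : IsReductionOrdering gt) {a b c : Tm L}
    (hab : WeakLe gt a b) (hac : gt a c) : gt b c := by
  rcases hab with rfl | hab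
  · exact hac
  · exact h.trans _ _ _ hab hac

theorem IsReductionOrdering.gt_of_gt_of_le (h : IsReductionOrdering gt) {a b c : Tm L}
    (hba : gt b a) (hca : WeakLe gt c a) : gt b c := by
  rcases hca with rfl | hca
  · exact hba
  · exact h.trans _ _ _ hba hca

theorem IsReductionOrdering.asymm (h : IsReductionOrdering gt) {a b : Tm L} (hab : gt a b) :
    ¬ gt b a := fun hba => h.irrefl a (h.trans _ _ _ hab hba)

theorem IsReductionOrdering.isWellOrderOn (h : IsReductionOrdering gt) :
    IsWellOrderOn {t : Tm L | IsGround t} gt :=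
  ⟨fun a _ => h.irrefl a, fun a _ b _ c _ => h.trans a b c,
    fun a ha b hb => h.total a b ha hb, Subrelation.wf (fun h' => h'.2.2) h.wf⟩

/-- Otherwise totality gives `t > f(…t…)` for an argument `t`, and compatibility with contexts
repeats this as `f(…t…) > f(…f(…t…)…)` and so on, an infinite descent. -/
theorem IsReductionOrdering.gt_arg (h : IsReductionOrdering gt) {n : ℕ} {f : L.Functions n}
    {ts : Fin n → Tm L} (hg : IsGround (Term.func f ts)) (i : Fin n) :
    gt (Term.func f ts) (ts i) := by
  rcases h.total _ _ hg (isGround_func.1 hg i)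
    (fun e => absurd (size_arg_lt f ts i) (by rw [e]; exact lt_irrefl _)) with h' | h'
  · exact h'
  · exfalso
    have hstep : ∀ t : Tm L, gt t (Term.func f (Function.update ts i t)) →
        gt (Term.func f (Function.update ts i t))
          (Term.func f (Function.update ts i (Term.func f (Function.update ts i t)))) := by
      intro t ht
      have := Replace.arg (l := t) (r := Term.func f (Function.update ts i t)) f
        (Function.update ts i t) i (Term.func f (Function.update ts i t))
        (by rw [Function.update_self]; exact Replace.root)
      rw [Function.update_idem] at this
      exact h.replace _ _ _ _ ht this
    have hno : ∀ t : Tm L, ¬ gt t (Term.func f (Function.update ts i t)) := by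
      intro t
      induction t using h.wf.induction with
      | _ t ih => exact fun ht => ih _ ht (hstep t ht)
    exact hno (ts i) (by rwa [Function.update_eq_self])

theorem IsReductionOrdering.le_of_isSubterm (h : IsReductionOrdering gt) {w s : Tm L}
    (hw : IsSubterm w s) (hs : IsGround s) : WeakLe gt w s := by
  induction hw with
  | refl => exact Or.inl rfl
  | arg f ts i _ ih =>
    exact h.le_trans (ih (isGround_func.1 hs i)) (Or.inr (h.gt_arg hs i))

/-- The arguments are lowered one at a time, each change being a rewrite step in a context. -/
theorem IsReductionOrdering.func_le_func (h : IsReductionOrdering gt) {n : ℕ}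
    {f : L.Functions n} {ts us : Fin n → Tm L} (hle : ∀ i, WeakLe gt (us i) (ts i)) :
    WeakLe gt (Term.func f us) (Term.func f ts) := by
  have key : ∀ A : Finset (Fin n),
      WeakLe gt (Term.func f fun i => if i ∈ A then us i else ts i) (Term.func f ts) := by
    intro A
    induction A using Finset.induction_on with
    | empty => left; simp
    | insert a A ha ih =>
      refine h.le_trans ?_ ih
      have hupd : (fun i => if i ∈ insert a A then us i else ts i) =
          Function.update (fun i => if i ∈ A then us i else ts i) a (us a) := by
        funext i
        by_cases hi : i = a
        · subst hi; simp
        · simp [hi]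
      rw [hupd]
      rcases hle a with e | hgt
      · left
        congr 1
        rw [Function.update_eq_self_iff]
        simp [ha, e]
      · right
        refine h.replace _ _ _ _ hgt (Replace.arg f _ a _ ?_)
        simp only [ha, if_false]
        exact Replace.root
  simpa using key Finset.univ

end Terms

/-! ### Normal forms for reduced ground rules, and the term model -/

section NormalForms

variable {L : FirstOrder.Language.{u, v}}

/-- `Eval R t n`: innermost rewriting with the rules `R` takes `t` to the normal form `n`. -/
inductive Eval (R : Tm L → Tm L → Prop) : Tm L → Tm L → Prop
  | stuck {n : ℕ} (f : L.Functions n) (ts us : Fin n → Tm L) :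
      (∀ i, Eval R (ts i) (us i)) → (∀ r, ¬ R (Term.func f us) r) →
      Eval R (Term.func f ts) (Term.func f us)
  | step {n : ℕ} (f : L.Functions n) (ts us : Fin n → Tm L) (r m : Tm L) :
      (∀ i, Eval R (ts i) (us i)) → R (Term.func f us) r → Eval R r m →
      Eval R (Term.func f ts) m

open Classical in
/-- The normal form of a ground term for the rules `R`. -/
noncomputable def nf (R : Tm L → Tm L → Prop) (t : Tm L) : Tm L :=
  if h : ∃ n, Eval R t n then h.choose else t

/-- `R` is a set of decreasing ground rules no left-hand side of which is reducible by another
rule. -/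
structure IsReduced (gt R : Tm L → Tm L → Prop) : Prop where
  ground_left : ∀ {l r}, R l r → IsGround l
  ground_right : ∀ {l r}, R l r → IsGround r
  gt : ∀ {l r}, R l r → gt l r
  unique : ∀ {l r l' r'}, R l r → R l' r' → IsSubterm l' l → l' = l ∧ r' = r

variable {gt R R' : Tm L → Tm L → Prop} {s t : Tm L}

theorem IsReduced.mono (h : IsReduced gt R') (hsub : ∀ l r, R l r → R' l r) :
    IsReduced gt R :=
  ⟨fun hr => h.ground_left (hsub _ _ hr), fun hr => h.ground_right (hsub _ _ hr),
    fun hr => h.gt (hsub _ _ hr), fun h1 h2 h3 => h.unique (hsub _ _ h1) (hsub _ _ h2) h3⟩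

theorem Eval.isGround_and_le (hgt : IsReductionOrdering gt) (hR : IsReduced gt R) {n : Tm L}
    (h : Eval R t n) (ht : IsGround t) : IsGround n ∧ WeakLe gt n t := by
  induction h with
  | stuck f ts us _ _ ih =>
    have ih' := fun i => ih i (isGround_func.1 ht i)
    exact ⟨isGround_func.2 fun i => (ih' i).1, hgt.func_le_func fun i => (ih' i).2⟩
  | step f ts us r m _ hr _ ih ihm =>
    have ih' := fun i => ih i (isGround_func.1 ht i)
    have hm := ihm (hR.ground_right hr)
    exact ⟨hm.1, hgt.le_trans hm.2 (hgt.le_trans (Or.inr (hR.gt hr))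
      (hgt.func_le_func fun i => (ih' i).2))⟩

/-- Termination: arguments are below the term by the subterm property, and the right-hand side of
the applied rule is below it because rules decrease. -/
theorem Eval.exists_of_isGround (hgt : IsReductionOrdering gt) (hR : IsReduced gt R)
    (ht : IsGround t) : ∃ n, Eval R t n := by
  induction t using hgt.wf.induction with
  | _ t ih =>
    cases t with
    | var x => exact absurd ht (not_isGround_var x)
    | func f ts =>
      have hts := isGround_func.1 ht
      choose us hus using fun i => ih (ts i) (hgt.gt_arg ht i) (hts i)
      by_cases hr : ∃ r, R (Term.func f us) r
      · obtain ⟨r, hr⟩ := hr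
        have hle : WeakLe gt (Term.func f us) (Term.func f ts) :=
          hgt.func_le_func fun i => ((hus i).isGround_and_le hgt hR (hts i)).2
        obtain ⟨m, hm⟩ := ih r (hgt.gt_of_le_of_gt hle (hR.gt hr)) (hR.ground_right hr)
        exact ⟨m, Eval.step f ts us r m hus hr hm⟩
      · exact ⟨_, Eval.stuck f ts us hus fun r h => hr ⟨r, h⟩⟩

/-- The innermost strategy fixes where to rewrite, and a reduced system has at most one rule for
each left-hand side. -/
theorem Eval.unique (hR : IsReduced gt R) {m n : Tm L} (hm : Eval R t m) (hn : Eval R t n) :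
    m = n := by
  induction hm generalizing n with
  | stuck f ts us _ hno ih =>
    cases hn with
    | stuck _ _ us' h' _ => rw [funext fun i => ih i (h' i)]
    | step _ _ us' r _ h' hr _ =>
      rw [← funext fun i => ih i (h' i)] at hr
      exact absurd hr (hno r)
  | step f ts us r m _ hr _ ih ihm =>
    cases hn with
    | stuck _ _ us' h' hno =>
      rw [← funext fun i => ih i (h' i)] at hno
      exact absurd hr (hno r)
    | step _ _ us' r' _ h' hr' hm' =>
      rw [← funext fun i => ih i (h' i)] at hr'
      obtain rfl := (hR.unique hr hr' IsSubterm.refl).2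
      exact ihm hm'

theorem Eval.self {n : Tm L} (h : Eval R t n) : Eval R n n := by
  induction h with
  | stuck f ts us _ hno ih => exact Eval.stuck f us us ih hno
  | step _ _ _ _ _ _ _ _ _ ihm => exact ihm

theorem eval_nf (hgt : IsReductionOrdering gt) (hR : IsReduced gt R) (ht : IsGround t) :
    Eval R t (nf R t) := by
  have h := Eval.exists_of_isGround hgt hR ht
  rw [nf, dif_pos h]
  exact h.choose_spec

theorem Eval.nf_eq (hR : IsReduced gt R) {n : Tm L} (h : Eval R t n) : nf R t = n := by
  have h' : ∃ n, Eval R t n := ⟨n, h⟩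
  rw [nf, dif_pos h']
  exact h'.choose_spec.unique hR h

theorem isGround_nf (hgt : IsReductionOrdering gt) (hR : IsReduced gt R) (ht : IsGround t) :
    IsGround (nf R t) := ((eval_nf hgt hR ht).isGround_and_le hgt hR ht).1

theorem nf_le (hgt : IsReductionOrdering gt) (hR : IsReduced gt R) (ht : IsGround t) :
    WeakLe gt (nf R t) t := ((eval_nf hgt hR ht).isGround_and_le hgt hR ht).2

theorem nf_nf (hgt : IsReductionOrdering gt) (hR : IsReduced gt R) (ht : IsGround t) :
    nf R (nf R t) = nf R t := (eval_nf hgt hR ht).self.nf_eq hR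

theorem eval_self_of_irreducible (ht : IsGround t)
    (h : ∀ l r, R l r → ¬ IsSubterm l t) : Eval R t t := by
  induction t with
  | var x => exact absurd ht (not_isGround_var x)
  | func f ts ih =>
    exact Eval.stuck f ts ts
      (fun i => ih i (isGround_func.1 ht i) fun l r hr hs => h l r hr (IsSubterm.arg f ts i hs))
      fun r hr => h _ r hr IsSubterm.refl

theorem nf_eq_self_of_irreducible (hR : IsReduced gt R) (ht : IsGround t)
    (h : ∀ l r, R l r → ¬ IsSubterm l t) : nf R t = t :=
  (eval_self_of_irreducible ht h).nf_eq hR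

/-- Evaluation begins with the arguments, and normal arguments evaluate to themselves. This is what
makes equality of normal forms a congruence. -/
theorem nf_func (hgt : IsReductionOrdering gt) (hR : IsReduced gt R) {n : ℕ}
    {f : L.Functions n} {ts : Fin n → Tm L} (hts : ∀ i, IsGround (ts i)) :
    nf R (Term.func f ts) = nf R (Term.func f fun i => nf R (ts i)) := by
  have h1 := fun i => eval_nf hgt hR (hts i)
  have h2 := fun i => (h1 i).self
  by_cases hr : ∃ r, R (Term.func f fun i => nf R (ts i)) r
  · obtain ⟨r, hr⟩ := hr
    have hm := eval_nf hgt hR (hR.ground_right hr)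
    rw [(Eval.step f ts _ r _ h1 hr hm).nf_eq hR, (Eval.step f _ _ r _ h2 hr hm).nf_eq hR]
  · have hno := fun r h => hr ⟨r, h⟩
    rw [(Eval.stuck f ts _ h1 hno).nf_eq hR, (Eval.stuck f _ _ h2 hno).nf_eq hR]

theorem nf_func_congr (hgt : IsReductionOrdering gt) (hR : IsReduced gt R) {n : ℕ}
    {f : L.Functions n} {ts us : Fin n → Tm L} (hts : ∀ i, IsGround (ts i))
    (hus : ∀ i, IsGround (us i)) (h : ∀ i, nf R (ts i) = nf R (us i)) :
    nf R (Term.func f ts) = nf R (Term.func f us) := by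
  rw [nf_func hgt hR hts, nf_func hgt hR hus, funext h]

/-- Proper subterms of a left-hand side are irreducible, so the evaluation of `l` immediately
applies the rule at the root. -/
theorem nf_rule (hgt : IsReductionOrdering gt) (hR : IsReduced gt R) {l r : Tm L}
    (h : R l r) : nf R l = nf R r := by
  have hl := hR.ground_left h
  cases l with
  | var x => exact absurd hl (not_isGround_var x)
  | func f ts =>
    refine (Eval.step f ts ts r _ (fun i => ?_) h
      (eval_nf hgt hR (hR.ground_right h))).nf_eq hR
    refine eval_self_of_irreducible (isGround_func.1 hl i) fun l' r' hr' hs => ?_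
    have hsub := hR.unique h hr' (IsSubterm.arg f ts i hs)
    have hle := hgt.le_of_isSubterm hs (isGround_func.1 hl i)
    rw [hsub.1] at hle
    exact hgt.irrefl _ (hgt.gt_of_le_of_gt hle (hgt.gt_arg hl i))

theorem nf_replace (hgt : IsReductionOrdering gt) (hR : IsReduced gt R) {w r s s' : Tm L}
    (h : Replace w r s s') (hs : IsGround s) (hr : IsGround r) (hwr : nf R w = nf R r) :
    nf R s = nf R s' := by
  induction h with
  | root => exact hwr
  | arg f ts i t' h' ih =>
    refine nf_func_congr hgt hR (isGround_func.1 hs)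
      (isGround_func.1 ((Replace.arg f ts i t' h').isGround hs hr)) fun j => ?_
    by_cases hj : j = i
    · subst hj
      simpa using ih (isGround_func.1 hs j)
    · simp [hj]

theorem nf_subst_congr (hgt : IsReductionOrdering gt) (hR : IsReduced gt R) {σ τ : Subst L}
    (hσ : IsGround (t.subst σ)) (hτ : IsGround (t.subst τ))
    (h : ∀ x ∈ t.varFinset, nf R (σ x) = nf R (τ x)) :
    nf R (t.subst σ) = nf R (t.subst τ) := by
  induction t with
  | var x => exact h x (by simp [Term.varFinset])
  | func f ts ih =>
    have hσ' := isGround_func.1 hσ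
    have hτ' := isGround_func.1 hτ
    exact nf_func_congr hgt hR hσ' hτ' fun i => ih i (hσ' i) (hτ' i) fun x hx =>
      h x (mem_varFinset_func.2 ⟨i, hx⟩)

/-- Rewriting the redex preserves the normal form but strictly decreases the term. -/
theorem nf_ne_self_of_isSubterm (hgt : IsReductionOrdering gt) (hR : IsReduced gt R)
    {l r : Tm L} (h : R l r) (hs : IsSubterm l s) (hg : IsGround s) : nf R s ≠ s := by
  intro e
  obtain ⟨s', hs'⟩ := hs.exists_replace r
  have hr := hR.ground_right h
  rw [nf_replace hgt hR hs' hg hr (nf_rule hgt hR h)] at e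
  have hle := nf_le hgt hR (hs'.isGround hg hr)
  rw [e] at hle
  exact hgt.irrefl _ (hgt.gt_of_le_of_gt hle (hgt.replace _ _ _ _ (hR.gt h) hs'))

/-- An irreducible `s` would be its own normal form, hence that of `t`, and so at most `t`. -/
theorem exists_isSubterm_of_nf_eq (hgt : IsReductionOrdering gt) (hR : IsReduced gt R)
    (hs : IsGround s) (ht : IsGround t) (hst : gt s t) (h : nf R s = nf R t) :
    ∃ l r, R l r ∧ IsSubterm l s := by
  by_contra hcon
  push Not at hcon
  rw [nf_eq_self_of_irreducible hR hs hcon] at h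
  have hle := nf_le hgt hR ht
  rw [← h] at hle
  exact hgt.irrefl _ (hgt.gt_of_le_of_gt hle hst)

/-- A redex in an instance by an irreducible substitution is at a nonvariable position. -/
theorem exists_nonvar_isSubterm (hgt : IsReductionOrdering gt) (hR : IsReduced gt R)
    {l r : Tm L} {θ : Subst L} (h : R l r) (hs : IsGround (s.subst θ))
    (hsub : IsSubterm l (s.subst θ)) (hθ : ∀ x ∈ s.varFinset, nf R (θ x) = θ x) :
    ∃ w, IsSubterm w s ∧ w.subst θ = l ∧ ∀ x : ℕ, w ≠ Term.var x := by
  induction s with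
  | var x =>
    -- A redex at or below a variable contradicts the irreducibility of the substitution.
    exact absurd (hθ x (by simp [Term.varFinset])) (nf_ne_self_of_isSubterm hgt hR h hsub hs)
  | func f ts ih =>
    generalize hq : (Term.func f ts).subst θ = q at hsub
    cases hsub with
    | refl => exact ⟨_, IsSubterm.refl, hq, fun x => by simp⟩
    | arg g us i hi =>
      simp only [Term.subst, Term.func.injEq] at hq
      obtain ⟨rfl, -, hus⟩ := hq
      obtain rfl := eq_of_heq hus
      obtain ⟨w, hw, hwl, hwv⟩ := ih i (isGround_func.1 hs i) hi fun x hx =>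
        hθ x (mem_varFinset_func.2 ⟨i, hx⟩)
      exact ⟨w, IsSubterm.arg f ts i hw, hwl, hwv⟩

/-- Every term met during the evaluation of `t` is at most `t`, so only rules with such left-hand
sides are consulted. -/
theorem Eval.congr_rules (hgt : IsReductionOrdering gt) (hR : IsReduced gt R) {n : Tm L}
    (h : Eval R t n) (ht : IsGround t)
    (hRR' : ∀ l r, WeakLe gt l t → (R l r ↔ R' l r)) : Eval R' t n := by
  induction h with
  | stuck f ts us hus hno ih =>
    have hts := isGround_func.1 ht
    refine Eval.stuck f ts us (fun i => ih i (hts i) fun l r hl =>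
      hRR' l r (hgt.le_trans hl (Or.inr (hgt.gt_arg ht i)))) fun r hr => hno r ?_
    exact (hRR' _ r (hgt.func_le_func fun i =>
      ((hus i).isGround_and_le hgt hR (hts i)).2)).2 hr
  | step f ts us r m hus hr _ ih ihm =>
    have hts := isGround_func.1 ht
    have hle : WeakLe gt (Term.func f us) (Term.func f ts) :=
      hgt.func_le_func fun i => ((hus i).isGround_and_le hgt hR (hts i)).2
    refine Eval.step f ts us r m (fun i => ih i (hts i) fun l r hl =>
      hRR' l r (hgt.le_trans hl (Or.inr (hgt.gt_arg ht i)))) ((hRR' _ r hle).1 hr) ?_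
    exact ihm (hR.ground_right hr) fun l r' hl => hRR' l r'
      (hgt.le_trans hl (hgt.le_trans (Or.inr (hR.gt hr)) hle))

theorem nf_congr_rules (hgt : IsReductionOrdering gt) (hR : IsReduced gt R)
    (hR' : IsReduced gt R') (ht : IsGround t)
    (hRR' : ∀ l r, WeakLe gt l t → (R l r ↔ R' l r)) : nf R t = nf R' t :=
  (((eval_nf hgt hR ht).congr_rules hgt hR ht hRR').nf_eq hR').symm

/-- Each step made with `R` is an equation valid for `R'`, and equality of `R'`-normal forms is a
congruence. -/
theorem nf_eq_nf_of_eval (hgt : IsReductionOrdering gt) (hR' : IsReduced gt R')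
    (hsub : ∀ l r, R l r → R' l r) {n : Tm L} (h : Eval R t n) (ht : IsGround t) :
    nf R' t = nf R' n := by
  have hR := hR'.mono hsub
  induction h with
  | stuck f ts us hus _ ih =>
    have hts := isGround_func.1 ht
    exact nf_func_congr hgt hR' hts (fun i => ((hus i).isGround_and_le hgt hR (hts i)).1)
      fun i => ih i (hts i)
  | step f ts us r m hus hr _ ih ihm =>
    have hts := isGround_func.1 ht
    rw [nf_func_congr hgt hR' hts (fun i => ((hus i).isGround_and_le hgt hR (hts i)).1)
      fun i => ih i (hts i), nf_rule hgt hR' (hsub _ _ hr)]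
    exact ihm (hR.ground_right hr)

theorem nf_eq_mono (hgt : IsReductionOrdering gt) (hR' : IsReduced gt R')
    (hsub : ∀ l r, R l r → R' l r) (hs : IsGround s) (ht : IsGround t)
    (h : nf R s = nf R t) : nf R' s = nf R' t := by
  have hR := hR'.mono hsub
  rw [nf_eq_nf_of_eval hgt hR' hsub (eval_nf hgt hR hs) hs,
    nf_eq_nf_of_eval hgt hR' hsub (eval_nf hgt hR ht) ht, h]

/-! ### Literals and clauses -/

theorem lit_comm (b : Bool) (s t : Tm L) : lit b s t = lit b t s := by
  simp only [lit, Sym2.eq_swap]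

theorem Literal.exists_eq_lit (ℓ : Literal L) : ∃ s t, ℓ = lit ℓ.pos s t := by
  obtain ⟨b, z⟩ := ℓ
  induction z with
  | _ s t => exact ⟨s, t, rfl⟩

theorem Literal.exists_eq_lit_of_mem {ℓ : Literal L} {s : Tm L} (h : s ∈ ℓ.sides) :
    ∃ t, ℓ = lit ℓ.pos s t := by
  obtain ⟨a, b, e⟩ := ℓ.exists_eq_lit
  rw [e] at h
  rcases Sym2.mem_iff.1 h with rfl | rfl
  · exact ⟨b, e⟩
  · exact ⟨a, e.trans (lit_comm _ _ _)⟩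

theorem mem_sides_lit {b : Bool} {s t w : Tm L} : w ∈ (lit b s t).sides ↔ w = s ∨ w = t :=
  Sym2.mem_iff

theorem lit_subst (b : Bool) (s t : Tm L) (σ : Subst L) :
    (lit b s t).subst σ = lit b (s.subst σ) (t.subst σ) := rfl

theorem Literal.eq_lit_of_subst_eq {ℓ : Literal L} {σ : Subst L} {b : Bool} {s t : Tm L}
    (h : ℓ.subst σ = lit b s t) : ∃ s' t', ℓ = lit b s' t' ∧ s'.subst σ = s ∧ t'.subst σ = t := by
  obtain ⟨a, c, e⟩ := ℓ.exists_eq_lit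
  rw [e, lit_subst] at h
  simp only [lit, Literal.mk.injEq] at h
  obtain ⟨hb, hz⟩ := h
  rw [hb] at e
  rcases Sym2.eq_iff.1 hz with ⟨h1, h2⟩ | ⟨h1, h2⟩
  · exact ⟨a, c, e, h1, h2⟩
  · exact ⟨c, a, e.trans (lit_comm _ _ _), h2, h1⟩

theorem Literal.isGround_lit {b : Bool} {s t : Tm L} :
    (lit b s t).IsGround ↔ Superposition.IsGround s ∧ Superposition.IsGround t := by
  simp only [Literal.IsGround, mem_sides_lit]
  exact ⟨fun h => ⟨h s (Or.inl rfl), h t (Or.inr rfl)⟩,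
    by rintro ⟨h1, h2⟩ w (rfl | rfl) <;> assumption⟩

theorem Literal.subst_subst (ℓ : Literal L) (σ τ : Subst L) :
    (ℓ.subst σ).subst τ = ℓ.subst (σ.comp τ) := by
  obtain ⟨s, t, e⟩ := ℓ.exists_eq_lit
  rw [e]
  simp only [lit_subst, Superposition.subst_subst]

theorem Clause.subst_cons (ℓ : Literal L) (C : Clause L) (σ : Subst L) :
    Clause.subst (ℓ ::ₘ C) σ = ℓ.subst σ ::ₘ C.subst σ := Multiset.map_cons ..

theorem Clause.subst_add (C D : Clause L) (σ : Subst L) :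
    Clause.subst (C + D) σ = C.subst σ + D.subst σ := Multiset.map_add ..

theorem Clause.mem_subst {C : Clause L} {σ : Subst L} {ℓ : Literal L} :
    ℓ ∈ C.subst σ ↔ ∃ k ∈ C, k.subst σ = ℓ := Multiset.mem_map

theorem Clause.subst_subst (C : Clause L) (σ τ : Subst L) :
    (C.subst σ).subst τ = C.subst (σ.comp τ) := by
  simp only [Clause.subst, Multiset.map_map, Function.comp_def, Literal.subst_subst]

theorem Clause.exists_cons {C : Clause L} {ℓ : Literal L} (h : ℓ ∈ C) :
    ∃ D : Clause L, C = ℓ ::ₘ D := Multiset.exists_cons_of_mem h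

theorem Literal.subst_congr {ℓ : Literal L} {σ τ : Subst L}
    (h : ∀ t ∈ ℓ.sides, ∀ x ∈ t.varFinset, σ x = τ x) : ℓ.subst σ = ℓ.subst τ := by
  obtain ⟨s, t, e⟩ := ℓ.exists_eq_lit
  rw [e] at h ⊢
  rw [lit_subst, lit_subst, subst_eq_subst_iff.2 (h s (mem_sides_lit.2 (Or.inl rfl))),
    subst_eq_subst_iff.2 (h t (mem_sides_lit.2 (Or.inr rfl)))]

theorem Clause.subst_congr {C : Clause L} {σ τ : Subst L} (h : ∀ x ∈ C.vars, σ x = τ x) :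
    C.subst σ = C.subst τ :=
  Multiset.map_congr rfl fun ℓ hℓ => Literal.subst_congr fun t ht x hx => h x ⟨ℓ, hℓ, t, ht, hx⟩

theorem Literal.subst_idSubst (ℓ : Literal L) : ℓ.subst idSubst = ℓ := by
  obtain ⟨s, t, e⟩ := ℓ.exists_eq_lit
  rw [e, lit_subst, Superposition.subst_idSubst, Superposition.subst_idSubst]

theorem Clause.subst_idSubst (C : Clause L) : C.subst idSubst = C := by
  conv_rhs => rw [← Multiset.map_id C]
  exact Multiset.map_congr rfl fun ℓ _ => ℓ.subst_idSubst

theorem Clause.IsGround.subst_eq {C : Clause L} (h : C.IsGround) (σ : Subst L) :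
    C.subst σ = C := by
  conv_rhs => rw [← Clause.subst_idSubst C]
  refine Multiset.map_congr rfl fun ℓ hℓ => Literal.subst_congr fun t ht x hx => ?_
  exact absurd hx (isGround_iff.1 (h ℓ hℓ t ht) x)

theorem Clause.isGround_cons {ℓ : Literal L} {C : Clause L} :
    Clause.IsGround (ℓ ::ₘ C) ↔ ℓ.IsGround ∧ C.IsGround := by
  simp [Clause.IsGround]

theorem Clause.isGround_add {C D : Clause L} :
    Clause.IsGround (C + D) ↔ C.IsGround ∧ D.IsGround := by
  simp only [Clause.IsGround, Multiset.mem_add]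
  exact ⟨fun h => ⟨fun ℓ hℓ => h ℓ (Or.inl hℓ), fun ℓ hℓ => h ℓ (Or.inr hℓ)⟩,
    fun h ℓ hℓ => hℓ.elim (h.1 ℓ) (h.2 ℓ)⟩

theorem Clause.isGround_of_mem_vars {C : Clause L} {θ : Subst L} (h : (C.subst θ).IsGround)
    {x : ℕ} (hx : x ∈ C.vars) : Superposition.IsGround (θ x) := by
  obtain ⟨ℓ, hℓ, t, ht, hxt⟩ := hx
  obtain ⟨s, e⟩ := Literal.exists_eq_lit_of_mem ht
  have hg := h _ (Clause.mem_subst.2 ⟨ℓ, hℓ, rfl⟩)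
  rw [e, lit_subst, Literal.isGround_lit] at hg
  exact isGround_subst.1 hg.1 x hxt

theorem Clause.isGround_subst_of_vars {C : Clause L} {θ : Subst L}
    (h : ∀ x ∈ C.vars, Superposition.IsGround (θ x)) : (C.subst θ).IsGround := by
  intro ℓ hℓ
  obtain ⟨k, hk, rfl⟩ := Clause.mem_subst.1 hℓ
  obtain ⟨s, t, e⟩ := k.exists_eq_lit
  have h' : ∀ w ∈ k.sides, Superposition.IsGround (w.subst θ) := fun w hw =>
    isGround_subst.2 fun x hx => h x ⟨k, hk, w, hw, hx⟩
  rw [e] at h' ⊢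
  rw [lit_subst, Literal.isGround_lit]
  exact ⟨h' s (mem_sides_lit.2 (Or.inl rfl)), h' t (mem_sides_lit.2 (Or.inr rfl))⟩

theorem Clause.finite_vars (C : Clause L) : C.vars.Finite := by
  have : C.vars = ⋃ ℓ ∈ {ℓ | ℓ ∈ C}, ⋃ t ∈ {t | t ∈ ℓ.sides}, (t.varFinset : Set ℕ) := by
    ext x
    simp [Clause.vars]
  rw [this]
  refine Set.Finite.biUnion (Multiset.finite_toSet C) fun ℓ _ => Set.Finite.biUnion ?_
    fun t _ => Finset.finite_toSet _
  obtain ⟨s, t, e⟩ := ℓ.exists_eq_lit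
  rw [e]
  exact (Set.toFinite {s, t}).subset fun w hw => mem_sides_lit.1 hw

theorem exists_perm_disjoint {A B : Set ℕ} (hA : A.Finite) (hB : B.Finite) :
    ∃ π : Equiv.Perm ℕ, ∀ x ∈ A, π x ∉ B := by
  obtain ⟨n, hn⟩ := (hA.union hB).bddAbove
  -- With `n` bounding both sets, the blocks `[0, n]` and `[n + 1, 2n + 1]` are exchanged.
  let f : ℕ → ℕ := fun x => if x < n + 1 then x + (n + 1) else if x < 2 * (n + 1) then x - (n + 1)
    else x
  have hf : Function.Involutive f := by
    intro x
    simp only [f]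
    split_ifs <;> omega
  refine ⟨hf.toPerm, fun x hx hB' => ?_⟩
  have h1 := hn (Or.inl hx)
  have h2 := hn (Or.inr hB')
  simp only [Function.Involutive.coe_toPerm, f] at h2
  split_ifs at h2 <;> omega

theorem Clause.mem_vars_of_subst_renameSubst {C : Clause L} {π : Equiv.Perm ℕ} {y : ℕ}
    (hy : y ∈ (C.subst (renameSubst π)).vars) : ∃ x ∈ C.vars, y = π x := by
  obtain ⟨ℓ, hℓ, t, ht, hyt⟩ := hy
  obtain ⟨k, hk, rfl⟩ := Clause.mem_subst.1 hℓ
  obtain ⟨s, hs, rfl⟩ := Sym2.mem_map.1 ht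
  obtain ⟨x, hx, hyx⟩ := mem_varFinset_subst.1 hyt
  exact ⟨x, ⟨k, hk, s, hs, hx⟩, by simpa [renameSubst, Term.varFinset] using hyx⟩

/-! ### Truth in the interpretation given by a set of rules -/

/-- Truth of a ground literal in the interpretation by normal forms. -/
def Literal.TrueIn (R : Tm L → Tm L → Prop) (ℓ : Literal L) : Prop :=
  ∃ s t : Tm L, ℓ.sides = s(s, t) ∧
    ((ℓ.pos = true ∧ nf R s = nf R t) ∨ (ℓ.pos = false ∧ nf R s ≠ nf R t))

/-- Truth of a ground clause in the interpretation by normal forms. -/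
def Clause.TrueIn (R : Tm L → Tm L → Prop) (C : Clause L) : Prop := ∃ ℓ ∈ C, ℓ.TrueIn R

theorem Literal.trueIn_pos : (lit true s t).TrueIn R ↔ nf R s = nf R t := by
  constructor
  · rintro ⟨a, b, h, ⟨-, e⟩ | ⟨h', -⟩⟩
    · rcases Sym2.eq_iff.1 h with ⟨rfl, rfl⟩ | ⟨rfl, rfl⟩
      · exact e
      · exact e.symm
    · exact absurd h' (by simp [lit])
  · exact fun e => ⟨s, t, rfl, Or.inl ⟨rfl, e⟩⟩

theorem Literal.trueIn_neg : (lit false s t).TrueIn R ↔ nf R s ≠ nf R t := by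
  constructor
  · rintro ⟨a, b, h, ⟨h', -⟩ | ⟨-, e⟩⟩
    · exact absurd h' (by simp [lit])
    · rcases Sym2.eq_iff.1 h with ⟨rfl, rfl⟩ | ⟨rfl, rfl⟩
      · exact e
      · exact e.symm
  · exact fun e => ⟨s, t, rfl, Or.inr ⟨rfl, e⟩⟩

theorem Literal.trueIn_congr {b : Bool} {s' t' : Tm L} (hs : nf R s = nf R s')
    (ht : nf R t = nf R t') : (lit b s t).TrueIn R ↔ (lit b s' t').TrueIn R := by
  cases b
  · rw [Literal.trueIn_neg, Literal.trueIn_neg, hs, ht]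
  · rw [Literal.trueIn_pos, Literal.trueIn_pos, hs, ht]

/-- The ground normal forms of `R`, the carrier of the term model. -/
def NormalForm (R : Tm L → Tm L → Prop) : Type u := {t : Tm L // IsGround t ∧ nf R t = t}

/-- The term model on normal forms. -/
@[reducible]
noncomputable def normalFormStructure (hgt : IsReductionOrdering gt) (hR : IsReduced gt R) :
    L.Structure (NormalForm R) where
  funMap := fun f ts => ⟨nf R (Term.func f fun i => (ts i).1),
    isGround_nf hgt hR (isGround_func.2 fun i => (ts i).2.1),
    nf_nf hgt hR (isGround_func.2 fun i => (ts i).2.1)⟩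
  RelMap := fun _ _ => False

theorem isGround_subst_normalForm (v : ℕ → NormalForm R) (t : Tm L) :
    IsGround (t.subst fun x => (v x).1) := isGround_subst.2 fun x _ => (v x).2.1

theorem realize_normalForm (hgt : IsReductionOrdering gt) (hR : IsReduced gt R)
    (v : ℕ → NormalForm R) (t : Tm L) :
    letI := normalFormStructure hgt hR
    (t.realize v).1 = nf R (t.subst fun x => (v x).1) := by
  let _ := normalFormStructure hgt hR
  induction t with
  | var x => exact (v x).2.2.symm
  | func f ts ih =>
    have h : (Term.realize v (Term.func f ts)).1 =
        nf R (Term.func f fun i => (Term.realize v (ts i)).1) := rfl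
    rw [h, funext ih]
    exact (nf_func hgt hR fun i => isGround_subst_normalForm v (ts i)).symm

/-- The carrier consists of ground terms, so a valuation is itself a grounding substitution, and
truth under it is truth of a ground instance. -/
theorem realize_clause_normalForm (hgt : IsReductionOrdering gt) (hR : IsReduced gt R)
    (v : ℕ → NormalForm R) (C : Clause L) :
    letI := normalFormStructure hgt hR
    (∃ ℓ ∈ C, ℓ.Realize (NormalForm R) v) ↔ (C.subst fun x => (v x).1).TrueIn R := by
  let _ := normalFormStructure hgt hR
  have heq : ∀ s t : Tm L, s.realize v = t.realize v ↔
      nf R (s.subst fun x => (v x).1) = nf R (t.subst fun x => (v x).1) := by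
    intro s t
    rw [← realize_normalForm hgt hR, ← realize_normalForm hgt hR]
    exact Subtype.ext_iff
  have hlit : ∀ ℓ : Literal L, ℓ.Realize (NormalForm R) v ↔
      (ℓ.subst fun x => (v x).1).TrueIn R := by
    intro ℓ
    constructor
    · rintro ⟨s, t, hst, h⟩
      refine ⟨s.subst _, t.subst _, by rw [Literal.subst, hst]; rfl, ?_⟩
      simp only [ne_eq, heq] at h
      exact h
    · obtain ⟨b, z⟩ := ℓ
      induction z with
      | _ s t =>
        intro h
        refine ⟨s, t, rfl, ?_⟩
        simp only [ne_eq, heq]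
        cases b
        · exact Or.inr ⟨rfl, Literal.trueIn_neg.1 h⟩
        · exact Or.inl ⟨rfl, Literal.trueIn_pos.1 h⟩
  constructor
  · rintro ⟨ℓ, hℓ, h⟩
    exact ⟨_, Clause.mem_subst.2 ⟨ℓ, hℓ, rfl⟩, (hlit ℓ).1 h⟩
  · rintro ⟨_, hk, h⟩
    obtain ⟨ℓ, hℓ, rfl⟩ := Clause.mem_subst.1 hk
    exact ⟨ℓ, hℓ, (hlit ℓ).2 h⟩

theorem nonempty_normalForm [Nonempty L.Constants] (hgt : IsReductionOrdering gt)
    (hR : IsReduced gt R) : Nonempty (NormalForm R) := by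
  obtain ⟨c⟩ := ‹Nonempty L.Constants›
  have hc : IsGround (c.term : Tm L) := isGround_func.2 fun i => i.elim0
  exact ⟨⟨nf R c.term, isGround_nf hgt hR hc, nf_nf hgt hR hc⟩⟩

/-- Entailment, which speaks of all structures, is applied to the term model. The constant is needed
to make its carrier nonempty. -/
theorem trueIn_of_entails [Nonempty L.Constants] (hgt : IsReductionOrdering gt)
    (hR : IsReduced gt R) {G : Set (Clause L)} {D : Clause L} (h : Entails G D)
    (hG : ∀ C ∈ G, C.IsGround ∧ C.TrueIn R) (hD : D.IsGround) : D.TrueIn R := by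
  let _ := normalFormStructure hgt hR
  have := nonempty_normalForm hgt hR
  have hM := h (NormalForm R) fun C hC v => (realize_clause_normalForm hgt hR v C).2
    (by rw [(hG C hC).1.subst_eq]; exact (hG C hC).2)
  have v : ℕ → NormalForm R := Classical.arbitrary _
  have := (realize_clause_normalForm hgt hR v D).1 (hM v)
  rwa [hD.subst_eq] at this

end NormalForms

/-! ### Comparison of term, literal and clause closures -/

section ClosureOrder

variable {L : FirstOrder.Language.{u, v}} {gt : Tm L → Tm L → Prop}
  {gtc : TermClosure L → TermClosure L → Prop}

theorem TermClosure.term_mk (t : Tm L) (σ : Subst L) : (TermClosure.mk t σ).term = t.subst σ :=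
  rfl

theorem TermClosure.exists_rep (c : TermClosure L) : ∃ t σ, c = TermClosure.mk t σ := by
  induction c using Quotient.inductionOn with
  | _ p => exact ⟨p.1, p.2, rfl⟩

theorem TermClosure.mk_congr {t : Tm L} {σ τ : Subst L} (h : t.subst σ = t.subst τ) :
    TermClosure.mk t σ = TermClosure.mk t τ :=
  Quotient.sound ⟨⟨Equiv.refl ℕ, Term.relabel_id t⟩, h⟩

theorem TermClosure.mk_rename {t : Tm L} {π : Equiv.Perm ℕ} {σ τ : Subst L}
    (h : ∀ x ∈ t.varFinset, σ (π x) = τ x) :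
    TermClosure.mk (t.subst (renameSubst π)) σ = TermClosure.mk t τ := by
  refine Quotient.sound ⟨⟨π.symm, ?_⟩, ?_⟩
  · change (t.subst (renameSubst π)).relabel π.symm = t
    rw [subst_renameSubst, Term.relabel_relabel]
    simp
  · change (t.subst (renameSubst π)).subst σ = t.subst τ
    rw [subst_subst, subst_eq_subst_iff]
    exact h

theorem IsClosureOrdering.gtc_of_gt (h : IsClosureOrdering gt gtc) {c d : TermClosure L}
    (hc : c.IsGround) (hd : d.IsGround) (hcd : gt c.term d.term) : gtc c d := by
  obtain ⟨s, σ, rfl⟩ := c.exists_rep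
  obtain ⟨t, τ, rfl⟩ := d.exists_rep
  exact h.extend s t σ τ hc hd (Or.inl hcd)

/-- For `c = s·τ`, either `s` is ground and both closures coincide, or `sτ` is a proper instance of
`s`, and ties are broken in favour of that. So `sτ·id` is the largest closure of the term `sτ`. -/
theorem IsClosureOrdering.le_mk_term (h : IsClosureOrdering gt gtc) {c : TermClosure L}
    (hc : c.IsGround) (σ : Subst L) : WeakLe gtc c (TermClosure.mk c.term σ) := by
  obtain ⟨s, τ, rfl⟩ := c.exists_rep
  have hg : IsGround (s.subst τ) := hc
  rw [TermClosure.term_mk]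
  by_cases hs : ∃ ρ : Subst L, (s.subst τ).subst ρ = s
  · left
    obtain ⟨ρ, hρ⟩ := hs
    rw [hg.subst_eq] at hρ
    have hs' : IsGround s := hρ ▸ hg
    rw [hρ]
    exact TermClosure.mk_congr (by rw [hs'.subst_eq, hs'.subst_eq])
  · right
    refine h.extend _ _ _ _ (by rwa [hg.subst_eq]) hc (Or.inr ⟨hg.subst_eq σ, ⟨τ, rfl⟩, hs⟩)

theorem IsClosureOrdering.isWellOrderOn (h : IsClosureOrdering gt gtc) :
    IsWellOrderOn {a : TermClosure L | a.IsGround} gtc :=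
  ⟨h.irrefl, fun a ha b hb c hc => h.trans a b c ha hb hc, fun a ha b hb => h.total a b ha hb,
    Subrelation.wf (fun ⟨h1, h2, h3⟩ => ⟨h3, h1, h2⟩) (Set.wellFoundedOn_iff.1 h.wf)⟩

/-- The multisets of ground term closures. -/
def groundLitKeys (L : FirstOrder.Language.{u, v}) : Set (Multiset (TermClosure L)) :=
  {A | ∀ a ∈ A, a ∈ {a : TermClosure L | a.IsGround}}

/-- The multisets of multisets of ground term closures. -/
def groundKeys (L : FirstOrder.Language.{u, v}) : Set (Multiset (Multiset (TermClosure L))) :=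
  {K | ∀ A ∈ K, A ∈ groundLitKeys L}

/-- The ordering of the multisets that represent clause closures. -/
def KeyGt (gtc : TermClosure L → TermClosure L → Prop) :
    Multiset (Multiset (TermClosure L)) → Multiset (Multiset (TermClosure L)) → Prop :=
  MultisetGt (LitClosureGt gtc)

theorem IsClosureOrdering.lit (h : IsClosureOrdering gt gtc) :
    IsWellOrderOn (groundLitKeys L) (LitClosureGt gtc) := h.isWellOrderOn.multisetGt

theorem IsClosureOrdering.key (h : IsClosureOrdering gt gtc) :
    IsWellOrderOn (groundKeys L) (KeyGt gtc) := h.lit.multisetGt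

/-! ### The multisets of literal closures -/

theorem closureMultiset_pos (s t : Tm L) (θ : Subst L) :
    (lit true s t).closureMultiset θ = {TermClosure.mk s θ, TermClosure.mk t θ} := rfl

theorem closureMultiset_neg (s t : Tm L) (θ : Subst L) :
    (lit false s t).closureMultiset θ = {TermClosure.mk s θ, TermClosure.mk t θ} +
      {TermClosure.mk (s.subst θ) idSubst, TermClosure.mk (t.subst θ) idSubst} := rfl

theorem Literal.mem_closureMultiset {ℓ : Literal L} {θ : Subst L} {c : TermClosure L}
    (h : c ∈ ℓ.closureMultiset θ) : c.term ∈ (ℓ.subst θ).sides := by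
  obtain ⟨s, t, e⟩ := ℓ.exists_eq_lit
  generalize ℓ.pos = b at e
  subst e
  rw [lit_subst, mem_sides_lit]
  cases b
  · rw [closureMultiset_neg] at h
    simp only [Multiset.insert_eq_cons, Multiset.mem_add, Multiset.mem_cons,
      Multiset.mem_singleton] at h
    rcases h with (rfl | rfl) | (rfl | rfl) <;>
      simp [TermClosure.term_mk, Superposition.subst_idSubst]
  · rw [closureMultiset_pos] at h
    simp only [Multiset.insert_eq_cons, Multiset.mem_cons, Multiset.mem_singleton] at h
    rcases h with rfl | rfl <;> simp [TermClosure.term_mk]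

theorem Literal.exists_mem_closureMultiset {ℓ : Literal L} {θ : Subst L} {w : Tm L}
    (h : w ∈ (ℓ.subst θ).sides) : ∃ c ∈ ℓ.closureMultiset θ, c.term = w := by
  obtain ⟨s, t, e⟩ := ℓ.exists_eq_lit
  generalize ℓ.pos = b at e
  subst e
  rw [lit_subst, mem_sides_lit] at h
  have hs : TermClosure.mk s θ ∈ (Superposition.lit b s t).closureMultiset θ := by
    cases b
    · simp [closureMultiset_neg]
    · simp [closureMultiset_pos]
  have ht : TermClosure.mk t θ ∈ (Superposition.lit b s t).closureMultiset θ := by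
    cases b
    · simp [closureMultiset_neg]
    · simp [closureMultiset_pos]
  rcases h with rfl | rfl
  · exact ⟨_, hs, rfl⟩
  · exact ⟨_, ht, rfl⟩

theorem Literal.closureMultiset_mem_groundLitKeys {ℓ : Literal L} {θ : Subst L}
    (h : (ℓ.subst θ).IsGround) : ℓ.closureMultiset θ ∈ groundLitKeys L :=
  fun _ hc => h _ (Literal.mem_closureMultiset hc)

theorem litClosureGt_of_forall_gt (h : IsClosureOrdering gt gtc) {k k' : Literal L}
    {τ τ' : Subst L} {w : Tm L} (hk : (k.subst τ).IsGround) (hk' : (k'.subst τ').IsGround)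
    (hw : w ∈ (k.subst τ).sides) (hgt : ∀ x ∈ (k'.subst τ').sides, gt w x) :
    LitClosureGt gtc (k.closureMultiset τ) (k'.closureMultiset τ') := by
  obtain ⟨c, hc, rfl⟩ := Literal.exists_mem_closureMultiset hw
  have hcg : c.IsGround := hk _ hw
  exact multisetGt_of_forall_gt (h.irrefl c hcg) hc fun d hd =>
    h.gtc_of_gt hcg (hk' _ (Literal.mem_closureMultiset hd))
      (hgt _ (Literal.mem_closureMultiset hd))

/-- This is the purpose of the extra entries `sθ·id` in `M_lc` of negative literals: they dominate a
side of a positive literal that represents the same term, however specific its closure is. -/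
theorem litClosureGt_neg_pos (h : IsClosureOrdering gt gtc) {k k' : Literal L}
    {τ τ' : Subst L} {s t a b : Tm L} (hk : k.subst τ = lit false s t)
    (hk' : k'.subst τ' = lit true a b) (hs : IsGround s)
    (ha : IsGround a) (hb : IsGround b) (has : WeakLe gt a s) (hbs : gt s b) :
    LitClosureGt gtc (k.closureMultiset τ) (k'.closureMultiset τ') := by
  obtain ⟨s, t, rfl, rfl, rfl⟩ := Literal.eq_lit_of_subst_eq hk
  obtain ⟨a, b, rfl, rfl, rfl⟩ := Literal.eq_lit_of_subst_eq hk'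
  rw [closureMultiset_neg, closureMultiset_pos]
  have hid : (TermClosure.mk (s.subst τ) idSubst).IsGround := by
    change IsGround ((s.subst τ).subst idSubst)
    rwa [subst_idSubst]
  have hidt : (TermClosure.mk (s.subst τ) idSubst).term = s.subst τ := by
    rw [TermClosure.term_mk, subst_idSubst]
  have hmb : gtc (TermClosure.mk (s.subst τ) idSubst) (TermClosure.mk b τ') :=
    h.gtc_of_gt hid hb (by rw [hidt]; exact hbs)
  have hma : WeakLe gtc (TermClosure.mk a τ') (TermClosure.mk (s.subst τ) idSubst) := by
    rcases has with e | hgt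
    · have := h.le_mk_term (c := TermClosure.mk a τ') ha idSubst
      rwa [TermClosure.term_mk, e] at this
    · exact Or.inr (h.gtc_of_gt hid ha (by rw [hidt]; exact hgt))
  -- If `a·τ'` equals `sτ·id`, the two cancel and the remaining `s·τ` still dominates `b·τ'`.
  -- Otherwise `sτ·id` alone dominates both sides.
  rcases hma with e | hma
  · have h1 : ({TermClosure.mk s τ, TermClosure.mk t τ} : Multiset (TermClosure L)) +
        {TermClosure.mk (s.subst τ) idSubst, TermClosure.mk (t.subst τ) idSubst} =
        {TermClosure.mk (s.subst τ) idSubst} + (TermClosure.mk s τ ::ₘ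
          {TermClosure.mk t τ, TermClosure.mk (t.subst τ) idSubst}) := by
      simp only [Multiset.insert_eq_cons, ← Multiset.singleton_add]
      abel
    have h2 : ({TermClosure.mk a τ', TermClosure.mk b τ'} : Multiset (TermClosure L)) =
        {TermClosure.mk (s.subst τ) idSubst} + {TermClosure.mk b τ'} := by
      rw [e, Multiset.insert_eq_cons, Multiset.singleton_add]
    rw [h1, h2]
    refine MultisetGt.add_left (multisetGt_of_forall_gt (y := TermClosure.mk s τ)
      (h.irrefl _ hs) (Multiset.mem_cons_self _ _) ?_) _
    intro x hx
    rw [Multiset.mem_singleton.1 hx]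
    exact h.gtc_of_gt hs hb hbs
  · refine multisetGt_of_forall_gt (h.irrefl _ hid)
      (y := TermClosure.mk (s.subst τ) idSubst) (by simp) ?_
    intro x hx
    simp only [Multiset.insert_eq_cons, Multiset.mem_cons, Multiset.mem_singleton] at hx
    rcases hx with rfl | rfl
    · exact hma
    · exact hmb

theorem litClosure_le_of_le (h : IsClosureOrdering gt gtc) {b : Bool} {s t s' t' : Tm L}
    {τ τ' : Subst L} (hs : IsGround (s.subst τ)) (ht : IsGround (t.subst τ))
    (hs' : IsGround (s'.subst τ')) (ht' : IsGround (t'.subst τ'))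
    (hss : WeakLe gtc (TermClosure.mk s' τ') (TermClosure.mk s τ))
    (htt : WeakLe gtc (TermClosure.mk t' τ') (TermClosure.mk t τ))
    (hss' : WeakLe gt (s'.subst τ') (s.subst τ)) (htt' : WeakLe gt (t'.subst τ') (t.subst τ)) :
    ((lit b s t).closureMultiset τ = (lit b s' t').closureMultiset τ' ∧
      (lit b s t).subst τ = (lit b s' t').subst τ') ∨
    LitClosureGt gtc ((lit b s t).closureMultiset τ) ((lit b s' t').closureMultiset τ') := by
  have hid : ∀ {w w' : Tm L}, IsGround w → IsGround w' → WeakLe gt w' w →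
      TermClosure.mk w idSubst = TermClosure.mk w' idSubst ∨
        gtc (TermClosure.mk w idSubst) (TermClosure.mk w' idSubst) := by
    rintro w w' hw hw' (rfl | hgt)
    · exact Or.inl rfl
    · refine Or.inr (h.gtc_of_gt ?_ ?_ ?_)
      · change IsGround (w.subst idSubst); rwa [subst_idSubst]
      · change IsGround (w'.subst idSubst); rwa [subst_idSubst]
      · rwa [TermClosure.term_mk, TermClosure.term_mk, subst_idSubst, subst_idSubst]
  have hgid : ∀ {w : Tm L}, IsGround w → (TermClosure.mk w idSubst).IsGround := by
    intro w hw
    change IsGround (w.subst idSubst)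
    rwa [subst_idSubst]
  -- Entries of the two multisets are matched in pairs. `P` covers the closures of the sides, and
  -- `Q` the additional entries of negative literals.
  let P : Multiset (TermClosure L × TermClosure L) :=
    {(TermClosure.mk s τ, TermClosure.mk s' τ'), (TermClosure.mk t τ, TermClosure.mk t' τ')}
  let Q : Multiset (TermClosure L × TermClosure L) :=
    {(TermClosure.mk (s.subst τ) idSubst, TermClosure.mk (s'.subst τ') idSubst),
      (TermClosure.mk (t.subst τ) idSubst, TermClosure.mk (t'.subst τ') idSubst)}
  have hP : ∀ p ∈ P, p.1.IsGround ∧ p.2.IsGround ∧ (p.1 = p.2 ∨ gtc p.1 p.2) := by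
    intro p hp
    simp only [P, Multiset.insert_eq_cons, Multiset.mem_cons, Multiset.mem_singleton] at hp
    rcases hp with rfl | rfl
    · exact ⟨hs, hs', hss.imp Eq.symm id⟩
    · exact ⟨ht, ht', htt.imp Eq.symm id⟩
  have hQ : ∀ p ∈ Q, p.1.IsGround ∧ p.2.IsGround ∧ (p.1 = p.2 ∨ gtc p.1 p.2) := by
    intro p hp
    simp only [Q, Multiset.insert_eq_cons, Multiset.mem_cons, Multiset.mem_singleton] at hp
    rcases hp with rfl | rfl
    · exact ⟨hgid hs, hgid hs', hid hs hs' hss'⟩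
    · exact ⟨hgid ht, hgid ht', hid ht ht' htt'⟩
  have hmain : ∀ A : Multiset (TermClosure L × TermClosure L), P ≤ A →
      (∀ p ∈ A, p.1.IsGround ∧ p.2.IsGround ∧ (p.1 = p.2 ∨ gtc p.1 p.2)) →
      (A.map Prod.fst = A.map Prod.snd ∧ (lit b s t).subst τ = (lit b s' t').subst τ') ∨
        LitClosureGt gtc (A.map Prod.fst) (A.map Prod.snd) := by
    intro A hPA hA
    rcases h.isWellOrderOn.multisetGt_map (f := Prod.fst) (g := Prod.snd)
      (fun p hp => (hA p hp).1) (fun p hp => (hA p hp).2.1) (fun p hp => (hA p hp).2.2) with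
      ⟨e, he⟩ | hgt
    · refine Or.inl ⟨e, ?_⟩
      have h1 := congrArg TermClosure.term (he (TermClosure.mk s τ, TermClosure.mk s' τ')
        (Multiset.mem_of_le hPA (by simp [P])))
      have h2 := congrArg TermClosure.term (he (TermClosure.mk t τ, TermClosure.mk t' τ')
        (Multiset.mem_of_le hPA (by simp [P])))
      simp only [TermClosure.term_mk] at h1 h2
      rw [lit_subst, lit_subst, h1, h2]
    · exact Or.inr hgt
  cases b
  · have := hmain (P + Q) (Multiset.le_add_right _ _) fun p hp =>
      (Multiset.mem_add.1 hp).elim (hP p) (hQ p)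
    simpa only [Multiset.map_add, P, Q, Multiset.insert_eq_cons, Multiset.map_cons,
      Multiset.map_singleton, closureMultiset_neg] using this
  · have := hmain P le_rfl hP
    simpa only [P, Multiset.insert_eq_cons, Multiset.map_cons,
      Multiset.map_singleton, closureMultiset_pos] using this

/-! ### The multisets of clause closures -/

theorem Clause.mem_closureMultiset {C : Clause L} {θ : Subst L} {A : Multiset (TermClosure L)}
    (h : A ∈ C.closureMultiset θ) :
    ∃ ℓ ∈ C, ∃ k τ, Literal.subst k τ = ℓ.subst θ ∧ A = k.closureMultiset τ := by
  unfold Clause.closureMultiset at h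
  split_ifs at h
  · obtain ⟨ℓ, hℓ, rfl⟩ := Multiset.mem_map.1 h
    exact ⟨ℓ, hℓ, ℓ, θ, rfl, rfl⟩
  · obtain ⟨ℓ, hℓ, rfl⟩ := Multiset.mem_map.1 h
    exact ⟨ℓ, hℓ, ℓ.subst θ, idSubst, Literal.subst_idSubst _, rfl⟩

theorem Clause.exists_mem_closureMultiset {C : Clause L} {θ : Subst L} {ℓ : Literal L}
    (h : ℓ ∈ C.subst θ) :
    ∃ k τ, Literal.subst k τ = ℓ ∧ k.closureMultiset τ ∈ C.closureMultiset θ := by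
  obtain ⟨ℓ, hℓ, rfl⟩ := Clause.mem_subst.1 h
  unfold Clause.closureMultiset
  split_ifs
  · exact ⟨ℓ, θ, rfl, Multiset.mem_map_of_mem _ hℓ⟩
  · exact ⟨ℓ.subst θ, idSubst, Literal.subst_idSubst _,
      Multiset.mem_map_of_mem (fun ℓ => (Literal.subst ℓ θ).closureMultiset idSubst) hℓ⟩

theorem Clause.closureMultiset_mem_groundKeys {C : Clause L} {θ : Subst L}
    (h : (C.subst θ).IsGround) : C.closureMultiset θ ∈ groundKeys L := by
  intro A hA
  obtain ⟨ℓ, hℓ, k, τ, e, rfl⟩ := Clause.mem_closureMultiset hA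
  exact Literal.closureMultiset_mem_groundLitKeys
    (e ▸ h _ (Clause.mem_subst.2 ⟨ℓ, hℓ, rfl⟩))

/-- `M_cc` stores `ℓ·θ` for unit clauses and `ℓθ·id` for the others. Quantifying over all closures
of the represented literal treats both cases at once. -/
theorem keyGt_of_forall_litGt (h : IsClosureOrdering gt gtc) {C D : Clause L} {θ ρ : Subst L}
    (hC : (C.subst θ).IsGround) {ℓ : Literal L}
    (hℓ : ℓ ∈ C.subst θ) (hgt : ∀ (k : Literal L) (τ : Subst L), k.subst τ = ℓ →
      ∀ (k' : Literal L) (τ' : Subst L),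
      k'.subst τ' ∈ D.subst ρ →
        LitClosureGt gtc (k.closureMultiset τ) (k'.closureMultiset τ')) :
    KeyGt gtc (C.closureMultiset θ) (D.closureMultiset ρ) := by
  obtain ⟨k, τ, e, hk⟩ := Clause.exists_mem_closureMultiset hℓ
  refine multisetGt_of_forall_gt (h.lit.irrefl _ (Clause.closureMultiset_mem_groundKeys hC _ hk))
    hk fun A hA => ?_
  obtain ⟨ℓ', hℓ', k', τ', e', rfl⟩ := Clause.mem_closureMultiset hA
  exact hgt k τ e k' τ' (e' ▸ Clause.mem_subst.2 ⟨ℓ', hℓ', rfl⟩)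

theorem keyGt_of_forall_gt (h : IsClosureOrdering gt gtc) {C D : Clause L} {θ ρ : Subst L}
    (hC : (C.subst θ).IsGround) (hD : (D.subst ρ).IsGround) {ℓ : Literal L} {w : Tm L}
    (hℓ : ℓ ∈ C.subst θ) (hw : w ∈ ℓ.sides)
    (hgt : ∀ k ∈ D.subst ρ, ∀ x ∈ k.sides, gt w x) :
    KeyGt gtc (C.closureMultiset θ) (D.closureMultiset ρ) :=
  keyGt_of_forall_litGt h hC hℓ fun _ _ e _ _ hk' =>
    litClosureGt_of_forall_gt h (e ▸ hC _ hℓ) (hD _ hk') (e ▸ hw) (hgt _ hk')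

theorem keyGt_of_neg (h : IsClosureOrdering gt gtc) {C D : Clause L} {θ ρ : Subst L}
    (hC : (C.subst θ).IsGround) (hD : (D.subst ρ).IsGround) {s t : Tm L}
    (hst : lit false s t ∈ C.subst θ)
    (hgt : ∀ k ∈ D.subst ρ, (∀ x ∈ k.sides, gt s x) ∨
      ∃ a b, k = lit true a b ∧ WeakLe gt a s ∧ gt s b) :
    KeyGt gtc (C.closureMultiset θ) (D.closureMultiset ρ) := by
  refine keyGt_of_forall_litGt h hC hst fun k τ e k' τ' hk' => ?_
  rcases hgt _ hk' with hgt | ⟨a, b, e', has, hbs⟩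
  · exact litClosureGt_of_forall_gt h (e ▸ hC _ hst) (hD _ hk')
      (e ▸ mem_sides_lit.2 (Or.inl rfl)) hgt
  · have hg := hD _ hk'
    rw [e', Literal.isGround_lit] at hg
    exact litClosureGt_neg_pos h e e' (Literal.isGround_lit.1 (hC _ hst)).1 hg.1 hg.2 has hbs

theorem subst_le_subst (hgt : IsReductionOrdering gt) {t : Tm L} {θ θ' : Subst L}
    (h : ∀ x ∈ t.varFinset, WeakLe gt (θ' x) (θ x)) :
    WeakLe gt (t.subst θ') (t.subst θ) := by
  induction t with
  | var x => exact h x (by simp [Term.varFinset])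
  | func f ts ih =>
    exact hgt.func_le_func fun i => ih i fun x hx => h x (mem_varFinset_func.2 ⟨i, hx⟩)

/-- Lowering the values of variables weakly lowers every entry, and a literal containing a changed
variable cannot keep both its multiset and its instance. -/
theorem keyGt_of_subst_lt (hgt : IsReductionOrdering gt) (h : IsClosureOrdering gt gtc)
    {C : Clause L} {θ θ' : Subst L} (hC : (C.subst θ).IsGround) (hC' : (C.subst θ').IsGround)
    (hle : ∀ x ∈ C.vars, WeakLe gt (θ' x) (θ x)) (hne : ∃ x ∈ C.vars, θ' x ≠ θ x) :
    KeyGt gtc (C.closureMultiset θ) (C.closureMultiset θ') := by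
  have hterm : ∀ ℓ ∈ C, ∀ t ∈ ℓ.sides, IsGround (t.subst θ) ∧ IsGround (t.subst θ') ∧
      WeakLe gt (t.subst θ') (t.subst θ) ∧
      WeakLe gtc (TermClosure.mk t θ') (TermClosure.mk t θ) ∧
      WeakLe gtc (TermClosure.mk (t.subst θ') idSubst)
        (TermClosure.mk (t.subst θ) idSubst) := by
    intro ℓ hℓ t ht
    have h1 : IsGround (t.subst θ) :=
      hC _ (Clause.mem_subst.2 ⟨ℓ, hℓ, rfl⟩) _ (Sym2.mem_map.2 ⟨t, ht, rfl⟩)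
    have h2 : IsGround (t.subst θ') :=
      hC' _ (Clause.mem_subst.2 ⟨ℓ, hℓ, rfl⟩) _ (Sym2.mem_map.2 ⟨t, ht, rfl⟩)
    have h3 : WeakLe gt (t.subst θ') (t.subst θ) :=
      subst_le_subst hgt fun x hx => hle x ⟨ℓ, hℓ, t, ht, hx⟩
    refine ⟨h1, h2, h3, ?_, ?_⟩
    · rcases h3 with e | h3
      · exact Or.inl (TermClosure.mk_congr e)
      · exact Or.inr (h.gtc_of_gt h1 h2 h3)
    · rcases h3 with e | h3
      · exact Or.inl (by rw [e])
      · refine Or.inr (h.gtc_of_gt ?_ ?_ ?_)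
        · change IsGround ((t.subst θ).subst idSubst); rwa [subst_idSubst]
        · change IsGround ((t.subst θ').subst idSubst); rwa [subst_idSubst]
        · rwa [TermClosure.term_mk, TermClosure.term_mk, subst_idSubst, subst_idSubst]
  have hlit : ∀ ℓ ∈ C, (ℓ.closureMultiset θ = ℓ.closureMultiset θ' ∧ ℓ.subst θ = ℓ.subst θ') ∨
      LitClosureGt gtc (ℓ.closureMultiset θ) (ℓ.closureMultiset θ') := by
    intro ℓ hℓ
    have ht := hterm ℓ hℓ
    obtain ⟨s, t, e⟩ := ℓ.exists_eq_lit
    rw [e] at ht ⊢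
    obtain ⟨h1, h2, h3, h4, -⟩ := ht s (mem_sides_lit.2 (Or.inl rfl))
    obtain ⟨h1', h2', h3', h4', -⟩ := ht t (mem_sides_lit.2 (Or.inr rfl))
    exact litClosure_le_of_le h h1 h1' h2 h2' h4 h4' h3 h3'
  have hlit' : ∀ ℓ ∈ C, ((ℓ.subst θ).closureMultiset idSubst =
        (ℓ.subst θ').closureMultiset idSubst ∧ ℓ.subst θ = ℓ.subst θ') ∨
      LitClosureGt gtc ((ℓ.subst θ).closureMultiset idSubst)
        ((ℓ.subst θ').closureMultiset idSubst) := by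
    intro ℓ hℓ
    have ht := hterm ℓ hℓ
    obtain ⟨s, t, e⟩ := ℓ.exists_eq_lit
    rw [e] at ht ⊢
    obtain ⟨h1, h2, h3, -, h4⟩ := ht s (mem_sides_lit.2 (Or.inl rfl))
    obtain ⟨h1', h2', h3', -, h4'⟩ := ht t (mem_sides_lit.2 (Or.inr rfl))
    have := litClosure_le_of_le (b := ℓ.pos) (s := s.subst θ) (t := t.subst θ)
      (s' := s.subst θ') (t' := t.subst θ') (τ := idSubst) (τ' := idSubst) h
      (by rwa [subst_idSubst]) (by rwa [subst_idSubst]) (by rwa [subst_idSubst])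
      (by rwa [subst_idSubst]) h4 h4' (by rwa [subst_idSubst, subst_idSubst])
      (by rwa [subst_idSubst, subst_idSubst])
    simpa only [lit_subst, subst_idSubst] using this
  have hfinal : ∀ f g : Literal L → Multiset (TermClosure L),
      (∀ ℓ ∈ C, f ℓ ∈ groundLitKeys L) → (∀ ℓ ∈ C, g ℓ ∈ groundLitKeys L) →
      (∀ ℓ ∈ C, (f ℓ = g ℓ ∧ ℓ.subst θ = ℓ.subst θ') ∨ LitClosureGt gtc (f ℓ) (g ℓ)) →
      KeyGt gtc (C.map f) (C.map g) := by
    intro f g hf hg hfg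
    refine (h.lit.multisetGt_map hf hg fun ℓ hℓ => (hfg ℓ hℓ).imp And.left id).resolve_left ?_
    rintro ⟨-, heq⟩
    obtain ⟨x, ⟨ℓ, hℓ, t, ht, hx⟩, hxne⟩ := hne
    rcases hfg ℓ hℓ with ⟨-, e⟩ | hlt
    · obtain ⟨s, e'⟩ := Literal.exists_eq_lit_of_mem ht
      have hle' := (hterm ℓ hℓ t ht).2.2.1
      have hs : s ∈ ℓ.sides := by rw [e']; exact mem_sides_lit.2 (Or.inr rfl)
      have hles := (hterm ℓ hℓ s hs).2.2.1
      rw [e', lit_subst, lit_subst] at e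
      simp only [lit, Literal.mk.injEq, true_and] at e
      -- Equality of unordered pairs permits a swap of the sides, but then `tθ'` and `tθ` bound each
      -- other.
      have htt : t.subst θ' = t.subst θ := by
        rcases Sym2.eq_iff.1 e with ⟨h1, -⟩ | ⟨h1, h2⟩
        · exact h1.symm
        · rw [h2, ← h1] at hles
          rcases hle' with h' | h'
          · exact h'
          · rcases hles with h'' | h''
            · exact h''.symm
            · exact absurd h'' (hgt.asymm h')
      exact hxne (subst_eq_subst_iff.1 htt x hx)
    · rw [heq ℓ hℓ] at hlt
      exact h.lit.irrefl _ (hg ℓ hℓ) hlt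
  have hg1 := fun ℓ (hℓ : ℓ ∈ C) => hC _ (Clause.mem_subst.2 ⟨ℓ, hℓ, rfl⟩)
  have hg2 := fun ℓ (hℓ : ℓ ∈ C) => hC' _ (Clause.mem_subst.2 ⟨ℓ, hℓ, rfl⟩)
  unfold Clause.closureMultiset
  split_ifs
  · exact hfinal _ _ (fun ℓ hℓ => Literal.closureMultiset_mem_groundLitKeys (hg1 ℓ hℓ))
      (fun ℓ hℓ => Literal.closureMultiset_mem_groundLitKeys (hg2 ℓ hℓ)) hlit
  · exact hfinal _ _
      (fun ℓ hℓ => Literal.closureMultiset_mem_groundLitKeys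
        (by rw [Literal.subst_idSubst]; exact hg1 ℓ hℓ))
      (fun ℓ hℓ => Literal.closureMultiset_mem_groundLitKeys
        (by rw [Literal.subst_idSubst]; exact hg2 ℓ hℓ)) hlit'

theorem Clause.subst_rename {C : Clause L} {π : Equiv.Perm ℕ} {τ ρ : Subst L}
    (h : ∀ x ∈ C.vars, τ (π x) = ρ x) :
    (C.subst (renameSubst π)).subst τ = C.subst ρ := by
  rw [Clause.subst_subst]
  exact Clause.subst_congr h

/-- Since term closures are identified up to renaming, renaming a premise apart does not move it in
the ordering. -/
theorem Clause.closureMultiset_rename {C : Clause L} {π : Equiv.Perm ℕ} {τ ρ : Subst L}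
    (h : ∀ x ∈ C.vars, τ (π x) = ρ x) :
    (C.subst (renameSubst π)).closureMultiset τ = C.closureMultiset ρ := by
  have hlit : ∀ ℓ ∈ C, (ℓ.subst (renameSubst π)).closureMultiset τ = ℓ.closureMultiset ρ := by
    intro ℓ hℓ
    have h1 : ∀ t ∈ ℓ.sides, TermClosure.mk (t.subst (renameSubst π)) τ = TermClosure.mk t ρ ∧
        (t.subst (renameSubst π)).subst τ = t.subst ρ := fun t ht =>
      have ht' := TermClosure.mk_rename (π := π) fun x hx => h x ⟨ℓ, hℓ, t, ht, hx⟩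
      ⟨ht', congrArg TermClosure.term ht'⟩
    obtain ⟨s, t, e⟩ := ℓ.exists_eq_lit
    generalize ℓ.pos = b at e
    subst e
    obtain ⟨hs, hs'⟩ := h1 s (mem_sides_lit.2 (Or.inl rfl))
    obtain ⟨ht, ht'⟩ := h1 t (mem_sides_lit.2 (Or.inr rfl))
    rw [lit_subst]
    cases b
    · rw [closureMultiset_neg, closureMultiset_neg, hs, ht, hs', ht']
    · rw [closureMultiset_pos, closureMultiset_pos, hs, ht]
  have hcard : (C.subst (renameSubst π)).card = C.card := Multiset.card_map _ _
  unfold Clause.closureMultiset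
  rw [hcard]
  split_ifs
  · rw [Clause.subst, Multiset.map_map]
    exact Multiset.map_congr rfl hlit
  · rw [Clause.subst, Multiset.map_map]
    refine Multiset.map_congr rfl fun ℓ hℓ => ?_
    rw [Function.comp_apply, Literal.subst_subst]
    congr 1
    exact Literal.subst_congr fun t ht x hx => h x ⟨ℓ, hℓ, t, ht, hx⟩

theorem Clause.subst_renameSubst_refl (C : Clause L) :
    C.subst (renameSubst (Equiv.refl ℕ)) = C := Clause.subst_idSubst C

theorem Clause.closureMultiset_congr {C : Clause L} {τ ρ : Subst L}
    (h : ∀ x ∈ C.vars, τ x = ρ x) : C.closureMultiset τ = C.closureMultiset ρ := by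
  have := Clause.closureMultiset_rename (π := Equiv.refl ℕ) h
  rwa [Clause.subst_renameSubst_refl] at this

theorem multiset_pair_eq_pair {α : Type*} {a b c d : α} (h : ({a, b} : Multiset α) = {c, d}) :
    (a = c ∧ b = d) ∨ (a = d ∧ b = c) := by
  have ha : a ∈ ({c, d} : Multiset α) := h ▸ Multiset.mem_cons_self a {b}
  simp only [Multiset.insert_eq_cons, Multiset.mem_cons, Multiset.mem_singleton] at ha
  rcases ha with rfl | rfl
  · left
    simpa using h
  · right
    rw [Multiset.pair_comm c] at h
    simpa using h

/-- The size of `M_lc` reveals the polarity (two entries or four), and the closures of a positive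
literal reveal the terms they represent. -/
theorem mem_of_closureMultiset_eq {C D : Clause L} {θ ρ : Subst L} {l r : Tm L}
    (h : C.closureMultiset θ = D.closureMultiset ρ) (hlr : lit true l r ∈ C.subst θ) :
    lit true l r ∈ D.subst ρ := by
  obtain ⟨k, τ, e, hk⟩ := Clause.exists_mem_closureMultiset hlr
  rw [h] at hk
  obtain ⟨ℓ, hℓ, k', τ', e', hA⟩ := Clause.mem_closureMultiset hk
  obtain ⟨l, r, rfl, rfl, rfl⟩ := Literal.eq_lit_of_subst_eq e
  obtain ⟨a, c, e''⟩ := k'.exists_eq_lit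
  generalize k'.pos = b at e''
  subst e''
  refine Clause.mem_subst.2 ⟨ℓ, hℓ, ?_⟩
  rw [← e', lit_subst]
  cases b
  · have := congrArg Multiset.card hA
    simp [closureMultiset_pos, closureMultiset_neg] at this
  · rw [closureMultiset_pos, closureMultiset_pos] at hA
    rcases multiset_pair_eq_pair hA with ⟨h1, h2⟩ | ⟨h1, h2⟩
    · rw [← TermClosure.term_mk, ← TermClosure.term_mk, ← h1, ← h2]
      rfl
    · rw [← TermClosure.term_mk, ← TermClosure.term_mk, ← h1, ← h2, lit_comm]
      rfl

end ClosureOrder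

/-! ### The candidate model and its counterexamples -/

section ModelConstruction

variable {L : FirstOrder.Language.{u, v}} {gt : Tm L → Tm L → Prop}
  {gtc : TermClosure L → TermClosure L → Prop} {sel : Clause L → Clause L} {N : Set (Clause L)}

/-- The ground closure `C·θ` contributes the rule `l → r`, where `R` is the set of rules
contributed by smaller closures. -/
structure Productive (gt : Tm L → Tm L → Prop) (gtc : TermClosure L → TermClosure L → Prop)
    (sel : Clause L → Clause L) (N : Set (Clause L)) (R : Tm L → Tm L → Prop) (C : Clause L)
    (θ : Subst L) (l r : Tm L) : Prop where
  mem : C ∈ N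
  ground : (C.subst θ).IsGround
  nonredundant : ¬ ClauseRedundant gtc N C
  decreasing : gt l r
  le_left : ∀ k ∈ C.subst θ, ∀ w ∈ k.sides, WeakLe gt w l
  notMem_neg : ∀ k ∈ C.subst θ, k.pos = false → l ∉ k.sides
  le_right : ∀ w, lit true l w ∈ C.subst θ → WeakLe gt w r
  not_trueIn : ¬ (C.subst θ).TrueIn R
  irreducible : ∀ l' r', R l' r' → ¬ IsSubterm l' l
  split : ∃ (l₀ r₀ : Tm L) (C' : Clause L), C = lit true l₀ r₀ ::ₘ C' ∧ lit true l₀ r₀ ∈ sel C ∧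
    l₀.subst θ = l ∧ r₀.subst θ = r ∧ ∀ w, lit true l w ∈ C'.subst θ → nf R r ≠ nf R w

/-- The rules contributed by the closures below `K`. -/
def rules (hgtc : IsClosureOrdering gt gtc) (sel : Clause L → Clause L) (N : Set (Clause L)) :
    Multiset (Multiset (TermClosure L)) → Tm L → Tm L → Prop :=
  hgtc.key.wf.fix fun K rec l r => ∃ (C : Clause L) (θ : Subst L)
    (h : C.closureMultiset θ ∈ groundKeys L ∧ K ∈ groundKeys L ∧
      KeyGt gtc K (C.closureMultiset θ)),
    Productive gt gtc sel N (rec (C.closureMultiset θ) h) C θ l r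

/-- The closure `C·θ` contributes the rule `l → r` to the model. -/
def Produces (hgtc : IsClosureOrdering gt gtc) (sel : Clause L → Clause L) (N : Set (Clause L))
    (C : Clause L) (θ : Subst L) (l r : Tm L) : Prop :=
  Productive gt gtc sel N (rules hgtc sel N (C.closureMultiset θ)) C θ l r

/-- The rules contributed by the closures whose multisets satisfy `Q`. -/
def rulesOf (hgtc : IsClosureOrdering gt gtc) (sel : Clause L → Clause L) (N : Set (Clause L))
    (Q : Multiset (Multiset (TermClosure L)) → Prop) (l r : Tm L) : Prop :=
  ∃ (C : Clause L) (θ : Subst L), Q (C.closureMultiset θ) ∧ Produces hgtc sel N C θ l r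

theorem rules_eq_rulesOf (hgtc : IsClosureOrdering gt gtc)
    {K : Multiset (Multiset (TermClosure L))} (hK : K ∈ groundKeys L) :
    rules hgtc sel N K = rulesOf hgtc sel N (KeyGt gtc K) := by
  funext l r
  rw [rules, WellFounded.fix_eq]
  apply propext
  constructor
  · rintro ⟨C, θ, h, hp⟩
    exact ⟨C, θ, h.2.2, hp⟩
  · rintro ⟨C, θ, h, hp⟩
    exact ⟨C, θ, ⟨Clause.closureMultiset_mem_groundKeys hp.ground, hK, h⟩, hp⟩

theorem Productive.mem_subst {R : Tm L → Tm L → Prop} {C : Clause L} {θ : Subst L} {l r : Tm L}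
    (h : Productive gt gtc sel N R C θ l r) : lit true l r ∈ C.subst θ := by
  obtain ⟨l₀, r₀, C', e, -, rfl, rfl, -⟩ := h.split
  exact Clause.mem_subst.2 ⟨lit true l₀ r₀, by rw [e]; exact Multiset.mem_cons_self _ _, rfl⟩

theorem Productive.keyGt_of_gt (hgt : IsReductionOrdering gt) (hgtc : IsClosureOrdering gt gtc)
    {R : Tm L → Tm L → Prop} {C D : Clause L} {θ ρ : Subst L} {l r w : Tm L} {k : Literal L}
    (h : Productive gt gtc sel N R C θ l r) (hD : (D.subst ρ).IsGround) (hk : k ∈ D.subst ρ)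
    (hw : w ∈ k.sides) (hwl : gt w l) :
    KeyGt gtc (D.closureMultiset ρ) (C.closureMultiset θ) :=
  keyGt_of_forall_gt hgtc hD h.ground hk hw fun k' hk' x hx =>
    hgt.gt_of_gt_of_le hwl (h.le_left k' hk' x hx)

/-- In `Cθ` the term `l` occurs only in positive literals, and with a strictly smaller partner since
`l ≈ l` would be true. So the negative literal dominates all of `Cθ`, even when `l = s`. -/
theorem Productive.keyGt_of_neg (hgt : IsReductionOrdering gt) (hgtc : IsClosureOrdering gt gtc)
    {R : Tm L → Tm L → Prop} {C D : Clause L} {θ ρ : Subst L} {l r s t : Tm L}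
    (h : Productive gt gtc sel N R C θ l r) (hD : (D.subst ρ).IsGround)
    (hst : lit false s t ∈ D.subst ρ) (hls : WeakLe gt l s) :
    KeyGt gtc (D.closureMultiset ρ) (C.closureMultiset θ) := by
  refine Superposition.keyGt_of_neg hgtc hD h.ground hst fun k hk => ?_
  by_cases hl : l ∈ k.sides
  · right
    obtain ⟨w, e⟩ := Literal.exists_eq_lit_of_mem hl
    have hpos : k.pos = true := by
      by_contra hneg
      exact h.notMem_neg k hk (by simpa using hneg) hl
    rw [hpos] at e
    refine ⟨l, w, e, hls, hgt.gt_of_le_of_gt hls ?_⟩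
    rcases h.le_left k hk w (by rw [e]; exact mem_sides_lit.2 (Or.inr rfl)) with rfl | hlt
    · exact absurd ⟨k, hk, by rw [e]; exact Literal.trueIn_pos.2 rfl⟩ h.not_trueIn
    · exact hlt
  · left
    intro x hx
    refine hgt.gt_of_le_of_gt hls ((h.le_left k hk x hx).resolve_left ?_)
    rintro rfl
    exact hl hx

/-- Suppose `l'` is a subterm of `l`. If it is smaller, its rule was contributed earlier, against
the irreducibility of `l`. If `l' = l`, neither closure can precede the other, so their multisets
agree; each then contains both equations, and maximality of the right-hand sides gives `r' = r`. -/
theorem isReduced_rulesOf (hgt : IsReductionOrdering gt) (hgtc : IsClosureOrdering gt gtc)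
    (Q : Multiset (Multiset (TermClosure L)) → Prop) :
    IsReduced gt (rulesOf hgtc sel N Q) := by
  have hground : ∀ {l r}, rulesOf hgtc sel N Q l r → IsGround l ∧ IsGround r := by
    rintro l r ⟨C, θ, -, hp⟩
    exact Literal.isGround_lit.1 (hp.ground _ hp.mem_subst)
  refine ⟨fun h => (hground h).1, fun h => (hground h).2,
    fun ⟨_, _, _, hp⟩ => hp.decreasing, ?_⟩
  rintro l r l' r' h1 h2 hsub
  have hl := (hground h1).1
  obtain ⟨C, θ, -, hC⟩ := h1
  obtain ⟨D, ρ, -, hD⟩ := h2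
  have hKC := Clause.closureMultiset_mem_groundKeys hC.ground
  have hKD := Clause.closureMultiset_mem_groundKeys hD.ground
  have hirr : ¬ KeyGt gtc (C.closureMultiset θ) (D.closureMultiset ρ) := fun hlt =>
    hC.irreducible l' r' (by rw [rules_eq_rulesOf hgtc hKC]; exact ⟨D, ρ, hlt, hD⟩) hsub
  rcases hgt.le_of_isSubterm hsub hl with rfl | hlt
  · have hirr' : ¬ KeyGt gtc (D.closureMultiset ρ) (C.closureMultiset θ) := fun hlt =>
      hD.irreducible l' r (by rw [rules_eq_rulesOf hgtc hKD]; exact ⟨C, θ, hlt, hC⟩) hsub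
    have hkey : C.closureMultiset θ = D.closureMultiset ρ := by
      by_contra hne
      rcases hgtc.key.total _ hKC _ hKD hne with h | h
      · exact hirr h
      · exact hirr' h
    refine ⟨rfl, ?_⟩
    rcases hC.le_right r' (mem_of_closureMultiset_eq hkey.symm hD.mem_subst) with e | h
    · exact e
    · rcases hD.le_right r (mem_of_closureMultiset_eq hkey hC.mem_subst) with e | h'
      · exact e.symm
      · exact absurd h' (hgt.asymm h)
  · exact absurd (hD.keyGt_of_gt hgt hgtc hC.ground hC.mem_subst
      (mem_sides_lit.2 (Or.inl rfl)) hlt) hirr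

theorem rulesOf_mono (hgtc : IsClosureOrdering gt gtc)
    {Q Q' : Multiset (Multiset (TermClosure L)) → Prop}
    (h : ∀ K ∈ groundKeys L, Q K → Q' K) (l r : Tm L)
    (hlr : rulesOf hgtc sel N Q l r) : rulesOf hgtc sel N Q' l r := by
  obtain ⟨C, θ, hQ, hp⟩ := hlr
  exact ⟨C, θ, h _ (Clause.closureMultiset_mem_groundKeys hp.ground) hQ, hp⟩

/-- Equations survive any enlargement of the rules. Disequations survive because later rules cannot
touch their sides. -/
theorem trueIn_rulesOf_mono (hgt : IsReductionOrdering gt) (hgtc : IsClosureOrdering gt gtc)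
    {D : Clause L} {ρ : Subst L} (hD : (D.subst ρ).IsGround)
    {Q : Multiset (Multiset (TermClosure L)) → Prop}
    (hQ : ∀ K ∈ groundKeys L, WeakLe (KeyGt gtc) K (D.closureMultiset ρ) → Q K)
    (h : (D.subst ρ).TrueIn
      (rulesOf hgtc sel N fun K => WeakLe (KeyGt gtc) K (D.closureMultiset ρ))) :
    (D.subst ρ).TrueIn (rulesOf hgtc sel N Q) := by
  obtain ⟨ℓ, hℓ, hT⟩ := h
  refine ⟨ℓ, hℓ, ?_⟩
  have hsub := rulesOf_mono (sel := sel) (N := N) hgtc hQ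
  have hredQ := isReduced_rulesOf (sel := sel) (N := N) hgt hgtc Q
  have hred := hredQ.mono hsub
  have hg := hD ℓ hℓ
  obtain ⟨s, t, e⟩ := ℓ.exists_eq_lit
  generalize ℓ.pos = b at e
  subst e
  rw [Literal.isGround_lit] at hg
  cases b
  -- By `Productive.keyGt_of_neg`, every rule whose left-hand side is at most a side of a negative
  -- literal of `Dρ` comes from a closure below `D·ρ`.
  · have hagree : ∀ s t, IsGround s → lit false s t ∈ D.subst ρ →
        nf (rulesOf hgtc sel N fun K => WeakLe (KeyGt gtc) K (D.closureMultiset ρ)) s =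
          nf (rulesOf hgtc sel N Q) s := by
      intro s t hs hst
      refine nf_congr_rules hgt hred hredQ hs fun l r hl => ⟨hsub l r, ?_⟩
      rintro ⟨C, θ, -, hp⟩
      exact ⟨C, θ, Or.inr (hp.keyGt_of_neg hgt hgtc hD hst hl), hp⟩
    rw [Literal.trueIn_neg] at hT ⊢
    rwa [← hagree s t hg.1 hℓ, ← hagree t s hg.2 (by rwa [lit_comm])]
  · rw [Literal.trueIn_pos] at hT ⊢
    exact nf_eq_mono hgt hredQ hsub hg.1 hg.2 hT

/-- The remaining literals of a productive closure stay false when larger closures contribute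
their rules. -/
theorem Produces.not_trueIn_rest (hgt : IsReductionOrdering gt)
    (hgtc : IsClosureOrdering gt gtc) {C C' : Clause L} {θ : Subst L} {l r l₀ r₀ : Tm L}
    (h : Produces hgtc sel N C θ l r) (hC : C = lit true l₀ r₀ ::ₘ C')
    (hmax : ∀ w, lit true l w ∈ C'.subst θ →
      nf (rules hgtc sel N (C.closureMultiset θ)) r ≠
        nf (rules hgtc sel N (C.closureMultiset θ)) w)
    {Q : Multiset (Multiset (TermClosure L)) → Prop}
    (hQ : ∀ K ∈ groundKeys L, WeakLe (KeyGt gtc) K (C.closureMultiset θ) → Q K) :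
    ¬ (C'.subst θ).TrueIn (rulesOf hgtc sel N Q) := by
  rintro ⟨ℓ, hℓ, hT⟩
  have hrules := rules_eq_rulesOf (sel := sel) (N := N) hgtc
    (Clause.closureMultiset_mem_groundKeys h.ground)
  rw [hrules] at hmax
  have hfalse := h.not_trueIn
  rw [hrules] at hfalse
  have hsub := rulesOf_mono (sel := sel) (N := N) (Q' := Q) hgtc fun K hKg hK =>
    hQ K hKg (Or.inr hK)
  have hredQ := isReduced_rulesOf (sel := sel) (N := N) hgt hgtc Q
  have hred := hredQ.mono hsub
  have hℓC : ℓ ∈ C.subst θ := by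
    rw [hC, Clause.subst_cons]
    exact Multiset.mem_cons_of_mem hℓ
  have hg := h.ground ℓ hℓC
  have hle := h.le_left ℓ hℓC
  obtain ⟨s, t, e⟩ := ℓ.exists_eq_lit
  generalize ℓ.pos = b at e
  subst e
  rw [Literal.isGround_lit] at hg
  have hfalse' : ¬ (lit b s t).TrueIn _ := fun hT' => hfalse ⟨_, hℓC, hT'⟩
  cases b
  · rw [Literal.trueIn_neg] at hT hfalse'
    -- A false disequation is a true equation, which persists.
    exact hT (nf_eq_mono hgt hredQ hsub hg.1 hg.2 (not_not.1 hfalse'))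
  -- Rules with left-hand side below `l` come from closures below `C·θ`, so terms below `l` already
  -- have their final normal forms.
  · have hagree : ∀ w, IsGround w → gt l w →
        nf (rulesOf hgtc sel N (KeyGt gtc (C.closureMultiset θ))) w =
          nf (rulesOf hgtc sel N Q) w := by
      intro w hw hlw
      refine nf_congr_rules hgt hred hredQ hw fun l' r' hl' => ⟨hsub l' r', ?_⟩
      rintro ⟨D, ρ, -, hp⟩
      exact ⟨D, ρ, hp.keyGt_of_gt hgt hgtc h.ground h.mem_subst (mem_sides_lit.2 (Or.inl rfl))
        (hgt.gt_of_gt_of_le hlw hl'), hp⟩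
    have hlr := Literal.isGround_lit.1 (h.ground _ h.mem_subst)
    -- Once `l → r` is present, truth of `l ≈ w` would mean that `r` and `w` have the same normal
    -- form, which productivity excludes.
    have hside : ∀ w, lit true l w ∈ C'.subst θ → lit true l w ∈ C.subst θ → IsGround w →
        nf (rulesOf hgtc sel N Q) l = nf (rulesOf hgtc sel N Q) w → False := by
      intro w hw hwC hwg e
      have hlw : gt l w := by
        refine (h.le_left _ hwC w (mem_sides_lit.2 (Or.inr rfl))).resolve_left ?_
        rintro rfl
        exact hfalse ⟨_, hwC, Literal.trueIn_pos.2 rfl⟩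
      rw [nf_rule hgt hredQ ⟨C, θ, hQ _ (Clause.closureMultiset_mem_groundKeys h.ground)
        (Or.inl rfl), h⟩, ← hagree r hlr.2 h.decreasing, ← hagree w hwg hlw] at e
      exact hmax w hw e
    rw [Literal.trueIn_pos] at hT hfalse'
    rcases hle s (mem_sides_lit.2 (Or.inl rfl)) with rfl | hs
    · exact hside t hℓ hℓC hg.2 hT
    · rcases hle t (mem_sides_lit.2 (Or.inr rfl)) with rfl | ht
      · exact hside s (by rwa [lit_comm]) (by rwa [lit_comm]) hg.1 hT.symm
      · rw [hagree s hg.1 hs, hagree t hg.2 ht] at hfalse'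
        exact hfalse' hT

/-! ### Counterexamples -/

/-- The ground closure `C·θ` is false in the model of the closures below it, in which all smaller
closures of `N` are true, but `C` is not redundant. -/
structure IsCounterexample (hgtc : IsClosureOrdering gt gtc) (sel : Clause L → Clause L)
    (N : Set (Clause L)) (C : Clause L) (θ : Subst L) : Prop where
  mem : C ∈ N
  ground : (C.subst θ).IsGround
  not_trueIn : ¬ (C.subst θ).TrueIn (rules hgtc sel N (C.closureMultiset θ))
  trueIn_of_lt : ∀ D ∈ N, ∀ ρ : Subst L, (D.subst ρ).IsGround →
    KeyGt gtc (C.closureMultiset θ) (D.closureMultiset ρ) →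
      (D.subst ρ).TrueIn (rules hgtc sel N (C.closureMultiset θ))

variable {hgtc : IsClosureOrdering gt gtc} {C : Clause L} {θ : Subst L}

theorem IsCounterexample.isReduced (hgt : IsReductionOrdering gt)
    (h : IsCounterexample hgtc sel N C θ) :
    IsReduced gt (rules hgtc sel N (C.closureMultiset θ)) := by
  rw [rules_eq_rulesOf hgtc (Clause.closureMultiset_mem_groundKeys h.ground)]
  exact isReduced_rulesOf hgt hgtc _

theorem IsCounterexample.trueIn_of_entails [Nonempty L.Constants] (hgt : IsReductionOrdering gt)
    (h : IsCounterexample hgtc sel N C θ) {G : Set (ClauseClosure L)} {D : Clause L}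
    (hG : G ⊆ GClos N) (hent : Entails (ClauseClosure.rep '' G) D) (hD : D.IsGround)
    (hlt : ∀ g ∈ G, KeyGt gtc (C.closureMultiset θ) (g.clause.closureMultiset g.sub)) :
    D.TrueIn (rules hgtc sel N (C.closureMultiset θ)) := by
  refine Superposition.trueIn_of_entails hgt (h.isReduced hgt) hent ?_ hD
  rintro _ ⟨g, hg, rfl⟩
  exact ⟨(hG hg).2, h.trueIn_of_lt g.clause (hG hg).1 g.sub (hG hg).2 (hlt g hg)⟩

/-- A redundant closure follows from smaller closures of `N`; these are true, so it would be true as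
well. -/
theorem IsCounterexample.not_redundant [Nonempty L.Constants] (hgt : IsReductionOrdering gt)
    (h : IsCounterexample hgtc sel N C θ) : ¬ ClauseRedundant gtc N C := by
  intro hred
  obtain ⟨G, hG, hent, hlt⟩ := hred θ h.ground
  exact h.not_trueIn (h.trueIn_of_entails hgt hG hent h.ground hlt)

/-- Normalizing a reducible `θ x` gives a smaller closure of the same clause, which is true; but
terms and their truth values are unchanged modulo the rules. -/
theorem IsCounterexample.nf_eq (hgt : IsReductionOrdering gt)
    (h : IsCounterexample hgtc sel N C θ) {x : ℕ} (hx : x ∈ C.vars) :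
    nf (rules hgtc sel N (C.closureMultiset θ)) (θ x) = θ x := by
  by_contra hne
  have hred := h.isReduced hgt
  set R := rules hgtc sel N (C.closureMultiset θ) with hR
  have hxg := Clause.isGround_of_mem_vars h.ground hx
  set θ' : Subst L := Function.update θ x (nf R (θ x)) with hθ'
  have hself : θ' x = nf R (θ x) := Function.update_self ..
  have hother : ∀ y, y ≠ x → θ' y = θ y := fun y hy => Function.update_of_ne hy ..
  have hground : (C.subst θ').IsGround := Clause.isGround_subst_of_vars fun y hy => by
    by_cases hyx : y = x
    · rw [hyx, hself]
      exact isGround_nf hgt hred hxg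
    · rw [hother y hyx]
      exact Clause.isGround_of_mem_vars h.ground hy
  have hlt : KeyGt gtc (C.closureMultiset θ) (C.closureMultiset θ') := by
    refine keyGt_of_subst_lt hgt hgtc h.ground hground (fun y _ => ?_)
      ⟨x, hx, by rw [hself]; exact hne⟩
    by_cases hyx : y = x
    · rw [hyx, hself]
      exact nf_le hgt hred hxg
    · exact Or.inl (hother y hyx)
  obtain ⟨_, hk, hT⟩ := h.trueIn_of_lt C h.mem θ' hground hlt
  obtain ⟨ℓ, hℓ, rfl⟩ := Clause.mem_subst.1 hk
  refine h.not_trueIn ⟨ℓ.subst θ, Clause.mem_subst.2 ⟨ℓ, hℓ, rfl⟩, ?_⟩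
  have hg := h.ground _ (Clause.mem_subst.2 ⟨ℓ, hℓ, rfl⟩)
  have hg' := hground _ hk
  have hnf : ∀ t ∈ ℓ.sides, IsGround (t.subst θ') → IsGround (t.subst θ) →
      nf R (t.subst θ') = nf R (t.subst θ) := by
    intro t _ h1 h2
    refine nf_subst_congr hgt hred h1 h2 fun y _ => ?_
    by_cases hyx : y = x
    · rw [hyx, hself]
      exact nf_nf hgt hred hxg
    · rw [hother y hyx]
  obtain ⟨s, t, e⟩ := ℓ.exists_eq_lit
  rw [e] at hnf hg hg' hT ⊢
  rw [lit_subst] at hg hg' hT ⊢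
  rw [Literal.isGround_lit] at hg hg'
  exact (Literal.trueIn_congr (hnf s (mem_sides_lit.2 (Or.inl rfl)) hg'.1 hg.1)
    (hnf t (mem_sides_lit.2 (Or.inr rfl)) hg'.2 hg.2)).1 hT

theorem isCopy_self (C : Clause L) : IsCopy sel C C (sel C) :=
  ⟨Equiv.refl ℕ, (Clause.subst_renameSubst_refl C).symm,
    (Clause.subst_renameSubst_refl (sel C)).symm⟩

/-- The redundant inference would make its conclusion true, whose literals all belong to the false
clause. -/
theorem IsCounterexample.no_equalityResolution [Nonempty L.Constants]
    (hgt : IsReductionOrdering gt) (hsat : Saturated gt gtc sel N)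
    (h : IsCounterexample hgtc sel N C θ) {s t : Tm L} (hst : lit false s t ∈ sel C)
    (hsel : sel C ≤ C) : s.subst θ ≠ t.subst θ := by
  intro e
  obtain ⟨C', hC⟩ := Clause.exists_cons (Multiset.mem_of_le hsel hst)
  obtain ⟨σ, hσ, hσθ⟩ := exists_isMGU e
  have hinf := Inference.equalityResolution (gt := gt) C' (sel C) s t σ hst hσ
  rw [← hC] at hinf
  have hground : (C'.subst θ).IsGround := by
    have := h.ground
    rw [hC, Clause.subst_cons, Clause.isGround_cons] at this
    exact this.2
  have hconc : (C'.subst σ).subst θ = C'.subst θ := by rw [Clause.subst_subst, hσθ]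
  obtain ⟨G, hG, hent, hlt⟩ := hsat _ _ _ hinf
    (by simpa using ⟨C, h.mem, h.not_redundant hgt, isCopy_self C⟩) θ hσθ
    (by simpa using h.ground) (by rwa [hconc])
  rw [hconc] at hent
  obtain ⟨ℓ, hℓ, hT⟩ := h.trueIn_of_entails hgt hG hent hground fun g hg => by
    obtain ⟨P, hP, hPg⟩ := hlt g hg
    obtain rfl : P = C := by simpa using hP
    exact hPg
  refine h.not_trueIn ⟨ℓ, ?_, hT⟩
  conv_lhs => rw [hC]
  rw [Clause.subst_cons]
  exact Multiset.mem_cons_of_mem hℓ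

/-- The new literal `t ≉ t'` would be false if the normal forms agreed, and the remaining literals
of the conclusion belong to the false clause. -/
theorem IsCounterexample.no_equalityFactoring [Nonempty L.Constants]
    (hgt : IsReductionOrdering gt) (hsat : Saturated gt gtc sel N)
    (h : IsCounterexample hgtc sel N C θ) {s t s' t' : Tm L} {C' : Clause L}
    (hC : C = lit true s t ::ₘ lit true s' t' ::ₘ C')
    (hsel : lit true s t ::ₘ lit true s' t' ::ₘ 0 ≤ sel C) (hss : s.subst θ = s'.subst θ)
    (hst : gt (s.subst θ) (t.subst θ)) (htt : WeakLe gt (t'.subst θ) (t.subst θ)) :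
    nf (rules hgtc sel N (C.closureMultiset θ)) (t.subst θ) ≠
      nf (rules hgtc sel N (C.closureMultiset θ)) (t'.subst θ) := by
  intro e
  obtain ⟨σ, hσ, hσθ⟩ := exists_isMGU hss
  have hσs : ∀ w : Tm L, (w.subst σ).subst θ = w.subst θ := fun w => by rw [subst_subst, hσθ]
  have hinf := Inference.equalityFactoring (gt := gt) C' (sel C) s t s' t' σ hsel hσ
    (by
      rintro (hlt | heq)
      · have := hgt.subst _ _ θ hlt
        rw [hσs, hσs] at this
        exact hgt.asymm hst this
      · have := congrArg (fun w => w.subst θ) heq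
        simp only [hσs] at this
        rw [this] at hst
        exact hgt.irrefl _ hst)
    (by
      intro hlt
      have := hgt.subst _ _ θ hlt
      rw [hσs, hσs] at this
      exact hgt.irrefl _ (hgt.gt_of_le_of_gt htt this))
  rw [← hC] at hinf
  have hground := h.ground
  rw [hC, Clause.subst_cons, Clause.subst_cons, Clause.isGround_cons, Clause.isGround_cons,
    lit_subst, lit_subst, Literal.isGround_lit, Literal.isGround_lit] at hground
  have hconc : (Clause.subst (lit true s t ::ₘ lit false t t' ::ₘ C') σ).subst θ =
      lit true (s.subst θ) (t.subst θ) ::ₘ lit false (t.subst θ) (t'.subst θ) ::ₘ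
        C'.subst θ := by
    rw [Clause.subst_subst, hσθ, Clause.subst_cons, Clause.subst_cons, lit_subst, lit_subst]
  have hground' : (Clause.IsGround (lit true (s.subst θ) (t.subst θ) ::ₘ
      lit false (t.subst θ) (t'.subst θ) ::ₘ C'.subst θ)) := by
    rw [Clause.isGround_cons, Clause.isGround_cons, Literal.isGround_lit, Literal.isGround_lit]
    exact ⟨hground.1, ⟨hground.1.2, hground.2.1.2⟩, hground.2.2⟩
  obtain ⟨G, hG, hent, hlt⟩ := hsat _ _ _ hinf
    (by simpa using ⟨C, h.mem, h.not_redundant hgt, isCopy_self C⟩) θ hσθ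
    (by simpa using h.ground) (by rwa [hconc])
  rw [hconc] at hent
  obtain ⟨ℓ, hℓ, hT⟩ := h.trueIn_of_entails hgt hG hent hground' fun g hg => by
    obtain ⟨P, hP, hPg⟩ := hlt g hg
    obtain rfl : P = C := by simpa using hP
    exact hPg
  have hmem : ∀ k, k = (lit true s t).subst θ ∨ k ∈ C'.subst θ → k ∈ C.subst θ := by
    intro k hk
    rw [hC, Clause.subst_cons, Clause.subst_cons]
    rcases hk with rfl | hk
    · exact Multiset.mem_cons_self _ _
    · exact Multiset.mem_cons_of_mem (Multiset.mem_cons_of_mem hk)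
  rcases Multiset.mem_cons.1 hℓ with rfl | hℓ
  · exact h.not_trueIn ⟨_, hmem _ (Or.inl rfl), hT⟩
  rcases Multiset.mem_cons.1 hℓ with rfl | hℓ
  · exact Literal.trueIn_neg.1 hT e
  · exact h.not_trueIn ⟨_, hmem _ (Or.inr hℓ), hT⟩

/-- A reducible larger side would permit superposition with the clause that contributed the rule.
Rewriting preserves the truth value of the selected literal, and the remaining literals of both
premises are false, so the true conclusion is impossible. -/
theorem IsCounterexample.no_superposition [Nonempty L.Constants]
    (hgt : IsReductionOrdering gt) (hsat : Saturated gt gtc sel N)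
    (h : IsCounterexample hgtc sel N C θ) {b : Bool} {s t : Tm L} (hst : lit b s t ∈ sel C)
    (hsel : sel C ≤ C) (hgt' : gt (s.subst θ) (t.subst θ)) {l r : Tm L}
    (hlr : rules hgtc sel N (C.closureMultiset θ) l r) : ¬ IsSubterm l (s.subst θ) := by
  intro hsub
  have hred := h.isReduced hgt
  have hrules := rules_eq_rulesOf (sel := sel) (N := N) hgtc
    (Clause.closureMultiset_mem_groundKeys h.ground)
  have hlr' := hlr
  rw [hrules] at hlr'
  obtain ⟨D, ρ, hDC, hD⟩ := hlr'
  obtain ⟨l₀, r₀, D', hDeq, hDsel, hl₀, hr₀, hmax⟩ := hD.split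
  obtain ⟨C', hC⟩ := Clause.exists_cons (Multiset.mem_of_le hsel hst)
  obtain ⟨π, hπ⟩ := exists_perm_disjoint D.finite_vars C.finite_vars
  classical
  -- One substitution serves both premises: it is `θ` on `C` and `ρ` transported along `π` on the
  -- renamed copy of `D`.
  set τ : Subst L := fun y => if y ∈ C.vars then θ y else ρ (π.symm y) with hτ
  have hτC : ∀ y ∈ C.vars, τ y = θ y := fun y hy => if_pos hy
  have hτD : ∀ x ∈ D.vars, τ (π x) = ρ x := fun x hx => by
    simp only [hτ, if_neg (hπ x hx), Equiv.symm_apply_apply]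
  have hCτ : C.subst τ = C.subst θ := Clause.subst_congr hτC
  have hkC : C.closureMultiset τ = C.closureMultiset θ := Clause.closureMultiset_congr hτC
  have hDτ : (D.subst (renameSubst π)).subst τ = D.subst ρ := Clause.subst_rename hτD
  have hkD : (D.subst (renameSubst π)).closureMultiset τ = D.closureMultiset ρ :=
    Clause.closureMultiset_rename hτD
  have hmemC : lit b s t ∈ C := Multiset.mem_of_le hsel hst
  have hmemD : lit true l₀ r₀ ∈ D := by rw [hDeq]; exact Multiset.mem_cons_self _ _
  have hsτ : s.subst τ = s.subst θ := subst_eq_subst_iff.2 fun x hx =>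
    hτC x ⟨_, hmemC, s, mem_sides_lit.2 (Or.inl rfl), hx⟩
  have htτ : t.subst τ = t.subst θ := subst_eq_subst_iff.2 fun x hx =>
    hτC x ⟨_, hmemC, t, mem_sides_lit.2 (Or.inr rfl), hx⟩
  set l₁ := l₀.subst (renameSubst π) with hl₁
  set r₁ := r₀.subst (renameSubst π) with hr₁
  have hl₁τ : l₁.subst τ = l := by
    rw [hl₁, subst_subst, ← hl₀]
    exact subst_eq_subst_iff.2 fun x hx =>
      hτD x ⟨_, hmemD, l₀, mem_sides_lit.2 (Or.inl rfl), hx⟩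
  have hr₁τ : r₁.subst τ = r := by
    rw [hr₁, subst_subst, ← hr₀]
    exact subst_eq_subst_iff.2 fun x hx =>
      hτD x ⟨_, hmemD, r₀, mem_sides_lit.2 (Or.inr rfl), hx⟩
  have hD₁ : D.subst (renameSubst π) = lit true l₁ r₁ ::ₘ D'.subst (renameSubst π) := by
    rw [hDeq, Clause.subst_cons, lit_subst]
  have hD'τ : (D'.subst (renameSubst π)).subst τ = D'.subst ρ :=
    Clause.subst_rename fun x ⟨k, hk, hx⟩ =>
      hτD x ⟨k, by rw [hDeq]; exact Multiset.mem_cons_of_mem hk, hx⟩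
  have hsg : IsGround (s.subst θ) ∧ IsGround (t.subst θ) :=
    Literal.isGround_lit.1 (h.ground _ (Clause.mem_subst.2 ⟨_, hmemC, rfl⟩))
  -- Irreducibility of the values of `θ` on `C` puts the redex at a nonvariable position of `s`, as
  -- the inference rule demands.
  obtain ⟨w, hws, hwl, hwv⟩ := exists_nonvar_isSubterm (θ := τ) hgt hred hlr
    (by rw [hsτ]; exact hsg.1) (by rwa [hsτ]) fun x hx => by
      have hxC : x ∈ C.vars := ⟨_, hmemC, s, mem_sides_lit.2 (Or.inl rfl), hx⟩
      rw [hτC x hxC]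
      exact h.nf_eq hgt hxC
  obtain ⟨s', hs'⟩ := hws.exists_replace r₁
  obtain ⟨σ, hσ, hστ⟩ := exists_isMGU (hl₁τ.trans hwl.symm)
  have hσs : ∀ w : Tm L, (w.subst σ).subst τ = w.subst τ := fun w => by rw [subst_subst, hστ]
  -- The ordering restrictions of the rule hold before instantiation because `gt` is stable under
  -- substitution.
  have horder : ∀ a c : Tm L, gt (a.subst τ) (c.subst τ) →
      ¬ (gt (c.subst σ) (a.subst σ) ∨ a.subst σ = c.subst σ) := by
    rintro a c hac (hlt | heq)
    · have := hgt.subst _ _ τ hlt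
      rw [hσs, hσs] at this
      exact hgt.asymm hac this
    · have := congrArg (fun w => w.subst τ) heq
      simp only [hσs] at this
      rw [this] at hac
      exact hgt.irrefl _ hac
  have hinf := Inference.superposition (gt := gt) (D'.subst (renameSubst π)) C'
    ((sel D).subst (renameSubst π)) (sel C) l₁ r₁ s t w s' b σ
    (Clause.mem_subst.2 ⟨_, hDsel, rfl⟩) hst
    (by
      rw [← hD₁, ← hC, Set.disjoint_left]
      intro y hy hyC
      obtain ⟨x, hx, rfl⟩ := Clause.mem_vars_of_subst_renameSubst hy
      exact hπ x hx hyC)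
    hwv hs' hσ (horder _ _ (by rw [hl₁τ, hr₁τ]; exact hD.decreasing))
    (horder _ _ (by rwa [hsτ, htτ]))
  rw [← hD₁, ← hC] at hinf
  have hconc : (Clause.subst (lit b s' t ::ₘ (D'.subst (renameSubst π) + C')) σ).subst τ =
      lit b (s'.subst τ) (t.subst τ) ::ₘ (D'.subst ρ + C'.subst τ) := by
    rw [Clause.subst_subst, hστ, Clause.subst_cons, Clause.subst_add, lit_subst, hD'τ]
  have hrep := hs'.subst τ
  rw [hwl, hr₁τ] at hrep
  have hsg' : IsGround (s.subst τ) := by rw [hsτ]; exact hsg.1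
  have hrg := hred.ground_right hlr
  have hs'g : IsGround (s'.subst τ) := hrep.isGround hsg' hrg
  have hnf := nf_replace hgt hred hrep hsg' hrg (nf_rule hgt hred hlr)
  have hD'g : (D'.subst ρ).IsGround := by
    have := hD.ground
    rw [hDeq, Clause.subst_cons, Clause.isGround_cons] at this
    exact this.2
  have hC'g : (C'.subst τ).IsGround := by
    have := h.ground
    rw [← hCτ, hC, Clause.subst_cons, Clause.isGround_cons] at this
    exact this.2
  have hground : Clause.IsGround
      (lit b (s'.subst τ) (t.subst τ) ::ₘ (D'.subst ρ + C'.subst τ)) := by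
    rw [Clause.isGround_cons, Clause.isGround_add, Literal.isGround_lit, htτ]
    exact ⟨⟨hs'g, hsg.2⟩, hD'g, hC'g⟩
  obtain ⟨G, hG, hent, hlt⟩ := hsat _ _ _ hinf
    (by
      intro p hp
      simp only [List.mem_cons, List.not_mem_nil, or_false] at hp
      rcases hp with rfl | rfl
      · exact ⟨D, hD.mem, hD.nonredundant, π, rfl, rfl⟩
      · exact ⟨C, h.mem, h.not_redundant hgt, isCopy_self C⟩) τ hστ
    (by
      intro P hP
      simp only [List.map_cons, List.map_nil, List.mem_cons, List.not_mem_nil, or_false] at hP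
      rcases hP with rfl | rfl
      · rw [hDτ]
        exact hD.ground
      · rw [hCτ]
        exact h.ground)
    (by rwa [hconc])
  rw [hconc] at hent
  have hKC := Clause.closureMultiset_mem_groundKeys h.ground
  obtain ⟨ℓ, hℓ, hT⟩ := h.trueIn_of_entails hgt hG hent hground fun g hg => by
    obtain ⟨P, hP, hPg⟩ := hlt g hg
    simp only [List.map_cons, List.map_nil, List.mem_cons, List.not_mem_nil, or_false] at hP
    have hPg' : KeyGt gtc (P.closureMultiset τ) (g.clause.closureMultiset g.sub) := hPg
    -- The left premise lies below `C·θ`, so closures smaller than either premise are smaller than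
    -- the counterexample.
    rcases hP with rfl | rfl
    · rw [hkD] at hPg'
      exact hgtc.key.trans _ hKC _ (Clause.closureMultiset_mem_groundKeys hD.ground) _
        (Clause.closureMultiset_mem_groundKeys (hG hg).2) hDC hPg'
    · rwa [hkC] at hPg'
  rcases Multiset.mem_cons.1 hℓ with rfl | hℓ
  · refine h.not_trueIn ⟨(lit b s t).subst θ, Clause.mem_subst.2 ⟨_, hmemC, rfl⟩, ?_⟩
    rw [lit_subst, ← hsτ, ← htτ]
    exact (Literal.trueIn_congr hnf rfl).2 hT
  rcases Multiset.mem_add.1 hℓ with hℓ | hℓ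
  -- A literal from the left premise was false when its rule was contributed, and it is still false
  -- with all rules below `C·θ`.
  · rw [hrules] at hT
    refine hD.not_trueIn_rest hgt hgtc hDeq hmax (Q := KeyGt gtc (C.closureMultiset θ)) ?_
      ⟨ℓ, hℓ, hT⟩
    rintro K hKg (rfl | hK)
    · exact hDC
    · exact hgtc.key.trans _ hKC _ (Clause.closureMultiset_mem_groundKeys hD.ground) _ hKg hDC hK
  · refine h.not_trueIn ⟨ℓ, ?_, hT⟩
    rw [← hCτ]
    conv_lhs => rw [hC]
    rw [Clause.subst_cons]
    exact Multiset.mem_cons_of_mem hℓ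

end ModelConstruction

/-! ### Counterexamples are productive, hence there are none -/

section Completeness

variable {L : FirstOrder.Language.{u, v}} {gt : Tm L → Tm L → Prop}
  {gtc : TermClosure L → TermClosure L → Prop} {sel : Clause L → Clause L} {N : Set (Clause L)}
  {hgtc : IsClosureOrdering gt gtc} {C : Clause L} {θ : Subst L}

/-- A false disequation has sides with a common normal form. Equal sides would permit equality
resolution; otherwise the larger side is reducible and permits superposition. -/
theorem IsCounterexample.no_negative_selected [Nonempty L.Constants]
    (hgt : IsReductionOrdering gt) (hsat : Saturated gt gtc sel N)
    (h : IsCounterexample hgtc sel N C θ) (hsel : sel C ≤ C) {ℓ : Literal L} (hℓ : ℓ ∈ sel C) :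
    ℓ.pos = true := by
  by_contra hneg
  obtain ⟨s, t, e⟩ := ℓ.exists_eq_lit
  rw [Bool.not_eq_true] at hneg
  rw [hneg] at e
  subst e
  have hmem : lit false (s.subst θ) (t.subst θ) ∈ C.subst θ :=
    Clause.mem_subst.2 ⟨_, Multiset.mem_of_le hsel hℓ, rfl⟩
  have hg := Literal.isGround_lit.1 (h.ground _ hmem)
  have hred := h.isReduced hgt
  have hnf : nf (rules hgtc sel N (C.closureMultiset θ)) (s.subst θ) =
      nf (rules hgtc sel N (C.closureMultiset θ)) (t.subst θ) := by
    by_contra hne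
    exact h.not_trueIn ⟨_, hmem, Literal.trueIn_neg.2 hne⟩
  rcases hgt.total _ _ hg.1 hg.2 (h.no_equalityResolution hgt hsat hℓ hsel) with hst | hts
  · obtain ⟨l, r, hlr, hsub⟩ := exists_isSubterm_of_nf_eq hgt hred hg.1 hg.2 hst hnf
    exact h.no_superposition hgt hsat hℓ hsel hst hlr hsub
  · obtain ⟨l, r, hlr, hsub⟩ := exists_isSubterm_of_nf_eq hgt hred hg.2 hg.1 hts hnf.symm
    rw [lit_comm] at hℓ
    exact h.no_superposition hgt hsat hℓ hsel hts hlr hsub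

theorem Clause.finite_sides (C : Clause L) : {w | ∃ k ∈ C, w ∈ k.sides}.Finite := by
  have : {w | ∃ k ∈ C, w ∈ k.sides} = ⋃ k ∈ {k | k ∈ C}, {w | w ∈ k.sides} := by
    ext w
    simp
  rw [this]
  refine Set.Finite.biUnion (Multiset.finite_toSet C) fun k _ => ?_
  obtain ⟨s, t, e⟩ := k.exists_eq_lit
  rw [e]
  exact (Set.toFinite {s, t}).subset fun w hw => mem_sides_lit.1 hw

/-- A counterexample contributes a rule to the model. -/
theorem IsCounterexample.exists_produces [Nonempty L.Constants]
    (hgt : IsReductionOrdering gt) (hsat : Saturated gt gtc sel N) (hsel : IsSelection gt sel)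
    (h : IsCounterexample hgtc sel N C θ) (hC : C ≠ 0) :
    ∃ l r, Produces hgtc sel N C θ l r := by
  classical
  have hle := (hsel C).1
  -- Selecting a negative literal is impossible here, so the selection contains all occurrences of
  -- maximal literals.
  have hall : ∀ ℓ ∈ C, IsMaximalLiteral gt C ℓ → (sel C).count ℓ = C.count ℓ := by
    rcases (hsel C).2 with ⟨ℓ, hℓ, hneg⟩ | hall
    · rw [h.no_negative_selected hgt hsat hle hℓ] at hneg
      exact absurd hneg (by simp)
    · intro ℓ hℓ hmax
      convert hall ℓ hℓ hmax
  obtain ⟨k, hk⟩ := Multiset.exists_mem_of_ne_zero hC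
  have hne : {w | ∃ k ∈ C.subst θ, w ∈ k.sides}.Nonempty := by
    obtain ⟨s, t, e⟩ := (k.subst θ).exists_eq_lit
    exact ⟨s, k.subst θ, Clause.mem_subst.2 ⟨k, hk, rfl⟩,
      by rw [e]; exact mem_sides_lit.2 (Or.inl rfl)⟩
  obtain ⟨l, ⟨k₀, hk₀, hlk₀⟩, hlmax⟩ := hgt.isWellOrderOn.exists_max
    (Clause.finite_sides (C.subst θ)) hne fun w ⟨k, hk, hw⟩ => h.ground k hk w hw
  have hselected : ∀ ℓ ∈ C, l ∈ (ℓ.subst θ).sides →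
      (sel C).count ℓ = C.count ℓ ∧ ℓ ∈ sel C ∧ ℓ.pos = true := by
    intro ℓ hℓ hlℓ
    obtain ⟨s, hs, hsl⟩ := Sym2.mem_map.1 hlℓ
    -- Maximality lifts from the instance: a side greater than `s` would remain greater after
    -- applying `θ`, against the choice of `l`.
    have hcount := hall ℓ hℓ ⟨s, hs, fun k hk t ht hts => by
      have hlt := hgt.subst _ _ θ hts
      rw [hsl] at hlt
      rcases hlmax (t.subst θ) ⟨k.subst θ, Clause.mem_subst.2 ⟨k, hk, rfl⟩,
        Sym2.mem_map.2 ⟨t, ht, rfl⟩⟩ with e | hlt'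
      · rw [e] at hlt
        exact hgt.irrefl _ hlt
      · exact hgt.asymm hlt hlt'⟩
    have hmem : ℓ ∈ sel C := by
      rw [← Multiset.count_pos, hcount]
      exact Multiset.count_pos.2 hℓ
    exact ⟨hcount, hmem, h.no_negative_selected hgt hsat hle hmem⟩
  have hpos : ∀ k ∈ C.subst θ, l ∈ k.sides → k.pos = true := by
    intro k hk hlk
    obtain ⟨ℓ, hℓ, rfl⟩ := Clause.mem_subst.1 hk
    exact (hselected ℓ hℓ hlk).2.2
  have hUsub : ∀ w, lit true l w ∈ C.subst θ → ∃ k ∈ C.subst θ, w ∈ k.sides :=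
    fun w hw => ⟨_, hw, mem_sides_lit.2 (Or.inr rfl)⟩
  obtain ⟨r, hr, hrmax⟩ := hgt.isWellOrderOn.exists_max (T := {w | lit true l w ∈ C.subst θ})
    ((Clause.finite_sides (C.subst θ)).subset hUsub)
    (by
      obtain ⟨w, e⟩ := Literal.exists_eq_lit_of_mem hlk₀
      rw [hpos k₀ hk₀ hlk₀] at e
      rw [e] at hk₀
      exact ⟨w, hk₀⟩)
    fun w hw => by
      obtain ⟨k, hk, hw'⟩ := hUsub w hw
      exact h.ground k hk w hw'
  obtain ⟨ℓ, hℓ, he⟩ := Clause.mem_subst.1 hr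
  obtain ⟨l₀, r₀, rfl, hl₀, hr₀⟩ := Literal.eq_lit_of_subst_eq he
  obtain ⟨C', hCC'⟩ := Clause.exists_cons hℓ
  have hselℓ := hselected _ hℓ (by rw [he]; exact mem_sides_lit.2 (Or.inl rfl))
  have hlr : gt l r := by
    rcases hlmax r (hUsub r hr) with e | hlt
    · refine absurd ⟨_, hr, ?_⟩ h.not_trueIn
      rw [e]
      exact Literal.trueIn_pos.2 rfl
    · exact hlt
  refine ⟨l, r, h.mem, h.ground, h.not_redundant hgt, hlr,
    fun k hk w hw => hlmax w ⟨k, hk, hw⟩, fun k hk hneg hl => ?_, hrmax, h.not_trueIn,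
    fun l' r' hR => ?_, l₀, r₀, C', hCC', hselℓ.2.1, hl₀, hr₀, fun w hw => ?_⟩
  · rw [hpos k hk hl] at hneg
    exact absurd hneg (by simp)
  · have := h.no_superposition hgt hsat hselℓ.2.1 hle (by rwa [hl₀, hr₀]) hR
    rwa [hl₀] at this
  · obtain ⟨ℓ', hℓ', he'⟩ := Clause.mem_subst.1 hw
    obtain ⟨l₁, w₁, rfl, hl₁, hw₁⟩ := Literal.eq_lit_of_subst_eq he'
    obtain ⟨C'', hC''⟩ := Clause.exists_cons hℓ'
    have hℓC : lit true l₁ w₁ ∈ C := by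
      rw [hCC']
      exact Multiset.mem_cons_of_mem hℓ'
    have hselℓ' := hselected _ hℓC (by rw [he']; exact mem_sides_lit.2 (Or.inl rfl))
    have hpair : lit true l₀ r₀ ::ₘ lit true l₁ w₁ ::ₘ 0 ≤ C := by
      rw [hCC', hC'']
      exact Multiset.cons_le_cons _ (Multiset.cons_le_cons _ (Multiset.zero_le _))
    -- The two literals may be equal, so membership does not suffice; equality of multiplicities
    -- supplies two selected occurrences.
    have hpair' : lit true l₀ r₀ ::ₘ lit true l₁ w₁ ::ₘ 0 ≤ sel C := by
      refine Multiset.le_iff_count.2 fun x => ?_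
      by_cases hx : x = lit true l₀ r₀ ∨ x = lit true l₁ w₁
      · have hcount : (sel C).count x = C.count x := by
          rcases hx with rfl | rfl
          · exact hselℓ.1
          · exact hselℓ'.1
        rw [hcount]
        exact Multiset.le_iff_count.1 hpair x
      · rw [Multiset.count_eq_zero_of_notMem]
        · exact Nat.zero_le _
        · simpa using hx
    have hwr := hrmax w (by
      change lit true l w ∈ C.subst θ
      rw [← he']
      exact Clause.mem_subst.2 ⟨_, hℓC, rfl⟩)
    have := h.no_equalityFactoring hgt hsat (hCC'.trans (by rw [hC''])) hpair'
      (hl₀.trans hl₁.symm) (by rwa [hl₀, hr₀]) (by rwa [hw₁, hr₀])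
    rwa [hr₀, hw₁] at this

/-- Every ground closure of `N` is true once the closures up to it have contributed their rules. -/
theorem trueIn_rulesOf_le [Nonempty L.Constants] (hgt : IsReductionOrdering gt)
    (hgtc : IsClosureOrdering gt gtc) (hsat : Saturated gt gtc sel N)
    (hsel : IsSelection gt sel) (hbot : (0 : Clause L) ∉ N) (hC : C ∈ N)
    (hg : (C.subst θ).IsGround) :
    (C.subst θ).TrueIn
      (rulesOf hgtc sel N fun K => WeakLe (KeyGt gtc) K (C.closureMultiset θ)) := by
  induction hK : C.closureMultiset θ using hgtc.key.wf.induction generalizing C θ with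
  | _ K ih =>
    subst hK
    have hKC := Clause.closureMultiset_mem_groundKeys hg
    have hrules := rules_eq_rulesOf (sel := sel) (N := N) hgtc hKC
    -- A rule may come from another closure with the same multiset. Its equation then also occurs in
    -- `Cθ` and makes it true.
    by_cases hprod : ∃ (D : Clause L) (ρ : Subst L) (l r : Tm L),
        D.closureMultiset ρ = C.closureMultiset θ ∧ Produces hgtc sel N D ρ l r
    · obtain ⟨D, ρ, l, r, hkey, hp⟩ := hprod
      refine ⟨lit true l r, mem_of_closureMultiset_eq hkey hp.mem_subst, Literal.trueIn_pos.2 ?_⟩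
      exact nf_rule hgt (isReduced_rulesOf hgt hgtc _) ⟨D, ρ, Or.inl hkey, hp⟩
    · have heq : rulesOf hgtc sel N (fun K => WeakLe (KeyGt gtc) K (C.closureMultiset θ)) =
          rules hgtc sel N (C.closureMultiset θ) := by
        rw [hrules]
        funext l r
        refine propext ⟨?_, rulesOf_mono hgtc (fun K _ hK => Or.inr hK) l r⟩
        rintro ⟨D, ρ, hkey | hlt, hp⟩
        · exact absurd ⟨D, ρ, l, r, hkey, hp⟩ hprod
        · exact ⟨D, ρ, hlt, hp⟩
      rw [heq]
      by_contra hfalse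
      -- Without such a rule, the rules up to `C·θ` are those below it. By induction and persistence
      -- all smaller closures are true in them, so a false `C·θ` would be a counterexample, and it
      -- would produce a rule after all.
      have hcex : IsCounterexample hgtc sel N C θ := by
        refine ⟨hC, hg, hfalse, fun D hD ρ hDg hlt => ?_⟩
        have hKD := Clause.closureMultiset_mem_groundKeys hDg
        have hDT := ih _ ⟨hKD, hKC, hlt⟩ hD hDg rfl
        rw [hrules]
        refine trueIn_rulesOf_mono hgt hgtc hDg ?_ hDT
        rintro K hKg (rfl | hK)
        · exact hlt
        · exact hgtc.key.trans _ hKC _ hKD _ hKg hlt hK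
      obtain ⟨l, r, hp⟩ := hcex.exists_produces hgt hsat hsel fun e => hbot (e ▸ hC)
      exact hprod ⟨C, θ, l, r, rfl, hp⟩

end Completeness

end Superposition

theorem theorem1 {L : FirstOrder.Language.{u, v}} [Nonempty L.Constants]
    (gt : Superposition.Tm L → Superposition.Tm L → Prop)
    (hgt : Superposition.IsReductionOrdering gt)
    (gtc : Superposition.TermClosure L → Superposition.TermClosure L → Prop)
    (hgtc : Superposition.IsClosureOrdering gt gtc)
    (sel : Superposition.Clause L → Superposition.Clause L)
    (hsel : Superposition.IsSelection gt sel)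
    (N : Set (Superposition.Clause L))
    (hsat : Superposition.Saturated gt gtc sel N)
    (hbot : (0 : Superposition.Clause L) ∉ N) :
    Superposition.Satisfiable N := by
  -- The model uses the rules of all closures. Each valuation in it is a grounding substitution, and
  -- the truth of every ground closure persists to the full system.
  have hR := Superposition.isReduced_rulesOf (sel := sel) (N := N) hgt hgtc fun _ => True
  refine ⟨_, Superposition.nonempty_normalForm hgt hR,
    Superposition.normalFormStructure hgt hR, fun C hC v => ?_⟩
  have hg : (C.subst fun x => (v x).1).IsGround :=
    Superposition.Clause.isGround_subst_of_vars fun x _ => (v x).2.1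
  exact (Superposition.realize_clause_normalForm hgt hR v C).2
    (Superposition.trueIn_rulesOf_mono hgt hgtc hg (fun _ _ _ => trivial)
      (Superposition.trueIn_rulesOf_le hgt hgtc hsat hsel hbot hC hg))
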